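/- Let $n\ge 0$, and write points of $\mathbb R^{2n+1}$ as $(\mathbf x,\mathbf y,z)$ with $\mathbf x,\mathbf y\in\mathbb R^n$ and $z\in\mathbb R$. Let $\xi_{\mathrm{st}}=\ker\bigl(dz+\sum_{i=1}^n x_i\,dy_i\bigr)$ be the standard contact structure on $\mathbb R^{2n+1}$, let $\xi_{\mathrm{rot}}=\ker\bigl(dz+\sum_{i=1}^n (x_i\,dy_i-y_i\,dx_i)\bigr)$ be the rotationally symmetric one, and let $L=\{(\mathbf 0,\mathbf 0,z)\mid z\ge 0\}$. For open sets $U,V\subset\mathbb R^{2n+1}$ and $\xi,\eta\in\{\xi_{\mathrm{st}},\xi_{\mathrm{rot}}\}$, call $(U,\xi)$ and $(V,\eta)$ contactomorphic if there is a $C^\infty$ diffeomorphism $\varphi\colon U\to V$ with $d\varphi(u)\,\xi(u)=\eta(\varphi(u))$ for all $u\in U$. A domain is a nonempty connected open set. (1) Let $U=\bigcup_{i=1}^\infty U_i$, where $U_1,U_2,\dots\subset\mathbb R^{2n+1}$ are bounded domains such that $\overline{U_i}\subset U_{i+1}$ for all $i$ and each $(U_i,\xi_{\mathrm{st}})$ is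 contactomorphic to $(\mathbb R^{2n+1},\xi_{\mathrm{st}})$. Then $(U,\xi_{\mathrm{st}})$ is contactomorphic to $(\mathbb R^{2n+1},\xi_{\mathrm{st}})$. (2) Both $(\mathbb R^{2n+1}\setminus L,\xi_{\mathrm{rot}})$ and $(\mathbb R^{2n+1}\setminus L,\xi_{\mathrm{st}})$ are contactomorphic to $(\mathbb R^{2n+1},\xi_{\mathrm{st}})$. -/

import Mathlib

open scoped ContDiff

noncomputable section

/-- The space `ℝ²ⁿ⁺¹` with coordinates `(x, y, z)`, where `x, y ∈ ℝⁿ` and `z ∈ ℝ`. Only its vector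
space structure, its topology, its smooth structure and its bounded sets are used, and these do not
depend on the choice of a norm. -/
abbrev ContactSpace (n : ℕ) : Type := (Fin n → ℝ) × (Fin n → ℝ) × ℝ

namespace ContactSpace

variable {n : ℕ}

/-- The covector `dxᵢ`. -/
def dx (i : Fin n) : ContactSpace n →L[ℝ] ℝ :=
  (ContinuousLinearMap.proj i).comp
    (ContinuousLinearMap.fst ℝ (Fin n → ℝ) ((Fin n → ℝ) × ℝ))

/-- The covector `dyᵢ`. -/
def dy (i : Fin n) : ContactSpace n →L[ℝ] ℝ :=
  (ContinuousLinearMap.proj i).comp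
    ((ContinuousLinearMap.fst ℝ (Fin n → ℝ) ℝ).comp
      (ContinuousLinearMap.snd ℝ (Fin n → ℝ) ((Fin n → ℝ) × ℝ)))

/-- The covector `dz`. -/
def dz : ContactSpace n →L[ℝ] ℝ :=
  (ContinuousLinearMap.snd ℝ (Fin n → ℝ) ℝ).comp
    (ContinuousLinearMap.snd ℝ (Fin n → ℝ) ((Fin n → ℝ) × ℝ))

/-- The standard contact form `α_st = dz + ∑ᵢ xᵢ dyᵢ`. -/
def alphaSt (p : ContactSpace n) : ContactSpace n →L[ℝ] ℝ :=
  dz + ∑ i, p.1 i • dy i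

/-- The rotationally symmetric contact form `α_rot = dz + ∑ᵢ (xᵢ dyᵢ - yᵢ dxᵢ)`. -/
def alphaRot (p : ContactSpace n) : ContactSpace n →L[ℝ] ℝ :=
  dz + ∑ i, (p.1 i • dy i - p.2.1 i • dx i)

/-- The standard contact structure `ξ_st = ker α_st`. -/
def xiSt (p : ContactSpace n) : Submodule ℝ (ContactSpace n) :=
  LinearMap.ker (alphaSt p : ContactSpace n →ₗ[ℝ] ℝ)

/-- The rotationally symmetric contact structure `ξ_rot = ker α_rot`. -/
def xiRot (p : ContactSpace n) : Submodule ℝ (ContactSpace n) :=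
  LinearMap.ker (alphaRot p : ContactSpace n →ₗ[ℝ] ℝ)

/-- `(U, ξ)` and `(V, η)` are contactomorphic: there is a smooth diffeomorphism `φ` from the open
set `U` onto the open set `V` with `dφ(u) ξ(u) = η(φ(u))` for all `u ∈ U`. The source and the target
of an `OpenPartialHomeomorph` are open, so `U` and `V` are open. -/
def Contactomorphic (U : Set (ContactSpace n))
    (ξ : ContactSpace n → Submodule ℝ (ContactSpace n))
    (V : Set (ContactSpace n))
    (η : ContactSpace n → Submodule ℝ (ContactSpace n)) : Prop :=
  ∃ φ : OpenPartialHomeomorph (ContactSpace n) (ContactSpace n),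
    φ.source = U ∧ φ.target = V ∧
    ContDiffOn ℝ ∞ φ U ∧ ContDiffOn ℝ ∞ φ.symm V ∧
    ∀ u ∈ U, (ξ u).map (fderiv ℝ φ u : ContactSpace n →ₗ[ℝ] ContactSpace n) = η (φ u)

/-- A domain: a nonempty connected open set. -/
def IsDomainSet (U : Set (ContactSpace n)) : Prop :=
  IsOpen U ∧ IsConnected U

/-- The closed half-line `L = {(0, 0, z) | z ≥ 0}`. -/
def halfLine (n : ℕ) : Set (ContactSpace n) :=
  {p | p.1 = 0 ∧ p.2.1 = 0 ∧ 0 ≤ p.2.2}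

end ContactSpace

end

/-! Everything rests on the contact dilations (x, y, z) ↦ (t x, t y, t² z), which multiply the
standard form by t², and on generating functions, which allow contact maps to be cut off without
integrating vector fields. A function S(X, y, z) generates the map from ((X + S_y)/(1 + S_z), y, z)
to (X, y + S_X, z + S − ∑ Xᵢ S_{Xᵢ}). If S is C²-small, both source and target maps are C¹-close to
the identity, hence global diffeomorphisms, and multiplying S by a cut-off keeps it small
(`exists_isContactoOn_of_cutoff`).

Two extension results follow. A dilation can be cut off outside a compact subset of a set that is
star-shaped for dilations: it is a power of a dilation close to the identity
(`exists_compactly_supported_dil`). Every contact germ at 0 extends globally: after a translation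
and a linear normalisation, it has a generating function whose relevant 2-jet vanishes, and
rescaling by dilations makes that function C²-small (`exists_isContactoOn_eventuallyEq`).

Hence a contact embedding ψ of the whole space agrees on any compact set with a global
contactomorphism (`IsContactoOn.exists_eqOn`). Let c be a cut-off dilation that shrinks the compact
set into a region where ψ coincides with a global g. With F = ψ c ψ⁻¹, extended by the identity, the
map F⁻¹ g c works. This corrects each contactomorphism of an exhaustion to extend the previous one
on a compact set, and a telescoping argument (`exists_isContactoOn_iUnion`) glues the corrected
maps, which proves (1).

For (2), the complement of the half-line is translated to a set star-shaped for dilations. Such a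
set V is the first term of the growing sequence of its dilates by powers of 2. Telescoping with
fixed source V and growing targets gives a contactomorphism onto the whole space
(`exists_isContactoOn_of_starShaped`). For the rotational structure, an explicit polynomial map
preserving the half-line carries it to the standard one. -/

noncomputable section

open Set Filter Topology

/-! ### Inverse functions and contact diffeomorphisms -/

/-- An injective local diffeomorphism on an open set, as an open partial homeomorphism with smooth
inverse. -/
theorem exists_openPartialHomeomorph_of_isInvertible_fderiv {E : Type*} [NormedAddCommGroup E]
    [NormedSpace ℝ E] [CompleteSpace E] {f : E → E} {U : Set E} (hU : IsOpen U)
    (hinj : InjOn f U) (hf : ∀ u ∈ U, ContDiffAt ℝ ∞ f u)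
    (hinv : ∀ u ∈ U, (fderiv ℝ f u).IsInvertible) :
    ∃ φ : OpenPartialHomeomorph E E, φ.source = U ∧ φ.target = f '' U ∧ ⇑φ = f ∧
      ∀ v ∈ f '' U, ContDiffAt ℝ ∞ φ.symm v := by
  have : Nonempty E := ⟨0⟩
  have hstrict : ∀ u ∈ U, ∃ D : E ≃L[ℝ] E, (D : E →L[ℝ] E) = fderiv ℝ f u ∧
      HasStrictFDerivAt f (D : E →L[ℝ] E) u := by
    intro u hu
    obtain ⟨D, hD⟩ := hinv u hu
    exact ⟨D, hD, hD ▸ (hf u hu).hasStrictFDerivAt (by simp)⟩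
  have hopen : IsOpenMap (U.domRestrict f) := by
    rw [isOpenMap_iff_nhds_le]
    rintro ⟨u, hu⟩
    obtain ⟨D, -, hD⟩ := hstrict u hu
    rw [Set.domRestrict_eq, ← Filter.map_map, map_nhds_subtype_coe_eq_nhds hu (hU.mem_nhds hu)]
    exact hD.map_nhds_eq_of_equiv.ge
  let e := (hinj.bijOn_image).toPartialEquiv f U (f '' U)
  let φ : OpenPartialHomeomorph E E := OpenPartialHomeomorph.ofContinuousOpenRestrict e
    (fun u hu => (hf u hu).continuousAt.continuousWithinAt) hopen hU
  refine ⟨φ, rfl, rfl, rfl, fun v hv => ?_⟩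
  obtain ⟨D, hD, hD'⟩ := hstrict (φ.symm v) (φ.map_target hv)
  exact φ.contDiffAt_symm (f₀' := D) hv hD'.hasFDerivAt (hf _ (φ.map_target hv))

namespace ContactSpace

variable {n : ℕ}

/-- `f` is near `u` a smooth contact embedding for `ξ_st`. -/
structure IsContactAt (f : ContactSpace n → ContactSpace n) (u : ContactSpace n) : Prop where
  contDiffAt : ContDiffAt ℝ ∞ f u
  isInvertible : (fderiv ℝ f u).IsInvertible
  exists_factor : ∃ c : ℝ, c ≠ 0 ∧ ∀ w, alphaSt (f u) (fderiv ℝ f u w) = c * alphaSt u w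

theorem IsContactAt.differentiableAt {f : ContactSpace n → ContactSpace n} {u : ContactSpace n}
    (h : IsContactAt f u) : DifferentiableAt ℝ f u :=
  h.contDiffAt.differentiableAt (by simp)

theorem IsContactAt.congr {f g : ContactSpace n → ContactSpace n} {u : ContactSpace n}
    (h : IsContactAt f u) (hfg : g =ᶠ[𝓝 u] f) : IsContactAt g u where
  contDiffAt := h.contDiffAt.congr_of_eventuallyEq hfg
  isInvertible := by rw [hfg.fderiv_eq]; exact h.isInvertible
  exists_factor := by rw [hfg.fderiv_eq, hfg.eq_of_nhds]; exact h.exists_factor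

theorem isContactAt_id (u : ContactSpace n) : IsContactAt id u where
  contDiffAt := contDiffAt_id
  isInvertible := by rw [fderiv_id]; exact ⟨.refl _ _, rfl⟩
  exists_factor := ⟨1, one_ne_zero, by simp⟩

theorem IsContactAt.comp {f g : ContactSpace n → ContactSpace n} {u : ContactSpace n}
    (hg : IsContactAt g (f u)) (hf : IsContactAt f u) : IsContactAt (g ∘ f) u where
  contDiffAt := hg.contDiffAt.comp u hf.contDiffAt
  isInvertible := by
    rw [fderiv_comp u hg.differentiableAt hf.differentiableAt]
    exact hg.isInvertible.comp hf.isInvertible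
  exists_factor := by
    obtain ⟨a, ha, hga⟩ := hg.exists_factor
    obtain ⟨b, hb, hfb⟩ := hf.exists_factor
    refine ⟨a * b, mul_ne_zero ha hb, fun w => ?_⟩
    rw [fderiv_comp u hg.differentiableAt hf.differentiableAt]
    simp [hga, hfb, mul_assoc]

/-- The conformal factor of f is nonzero and its derivative is invertible, so both can be divided
out. With g a local inverse of f, this is why inverses of contact maps are contact. -/
theorem IsContactAt.of_comp_right {f g : ContactSpace n → ContactSpace n} {u : ContactSpace n}
    (hg : ContDiffAt ℝ ∞ g (f u)) (hf : IsContactAt f u) (hgf : IsContactAt (g ∘ f) u) :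
    IsContactAt g (f u) where
  contDiffAt := hg
  isInvertible := by
    have h := hgf.isInvertible
    rw [fderiv_comp u (hg.differentiableAt (by simp)) hf.differentiableAt] at h
    obtain ⟨D, hD⟩ := hf.isInvertible
    rwa [← hD, ContinuousLinearMap.isInvertible_comp_equiv] at h
  exists_factor := by
    obtain ⟨a, ha, hga⟩ := hgf.exists_factor
    obtain ⟨b, hb, hfb⟩ := hf.exists_factor
    refine ⟨a / b, div_ne_zero ha hb, fun w => ?_⟩
    obtain ⟨w, rfl⟩ := hf.isInvertible.surjective w
    rw [fderiv_comp u (hg.differentiableAt (by simp)) hf.differentiableAt] at hga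
    have := hga w
    simp only [Function.comp_apply, ContinuousLinearMap.comp_apply] at this
    rw [this, hfb]
    field_simp

/-- `f` restricts to a contactomorphism from the open set `U` onto `V`, for `ξ_st`. -/
structure IsContactoOn (f : ContactSpace n → ContactSpace n) (U V : Set (ContactSpace n)) :
    Prop where
  isOpen : IsOpen U
  bijOn : BijOn f U V
  isContactAt : ∀ u ∈ U, IsContactAt f u

namespace IsContactoOn

variable {f g : ContactSpace n → ContactSpace n} {U V W : Set (ContactSpace n)}

protected theorem id (hU : IsOpen U) : IsContactoOn id U U :=
  ⟨hU, bijOn_id U, fun u _ => isContactAt_id u⟩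

theorem comp (hg : IsContactoOn g V W) (hf : IsContactoOn f U V) : IsContactoOn (g ∘ f) U W :=
  ⟨hf.isOpen, hg.bijOn.comp hf.bijOn, fun u hu =>
    (hg.isContactAt _ (hf.bijOn.mapsTo hu)).comp (hf.isContactAt u hu)⟩

theorem mono (hf : IsContactoOn f U V) (hW : IsOpen W) (hWU : W ⊆ U) :
    IsContactoOn f W (f '' W) :=
  ⟨hW, (hf.bijOn.injOn.mono hWU).bijOn_image, fun u hu => hf.isContactAt u (hWU hu)⟩

theorem exists_openPartialHomeomorph (h : IsContactoOn f U V) :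
    ∃ φ : OpenPartialHomeomorph (ContactSpace n) (ContactSpace n), φ.source = U ∧ φ.target = V ∧
      ⇑φ = f ∧ ∀ v ∈ V, ContDiffAt ℝ ∞ φ.symm v := by
  have := exists_openPartialHomeomorph_of_isInvertible_fderiv h.isOpen h.bijOn.injOn
    (fun u hu => (h.isContactAt u hu).contDiffAt) (fun u hu => (h.isContactAt u hu).isInvertible)
  rwa [h.bijOn.image_eq] at this

theorem isOpen_target (h : IsContactoOn f U V) : IsOpen V := by
  obtain ⟨φ, -, rfl, -⟩ := h.exists_openPartialHomeomorph
  exact φ.open_target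

theorem continuousOn (h : IsContactoOn f U V) : ContinuousOn f U :=
  fun u hu => (h.isContactAt u hu).contDiffAt.continuousAt.continuousWithinAt

theorem exists_inverse (h : IsContactoOn f U V) :
    ∃ g, IsContactoOn g V U ∧ InvOn g f U V := by
  obtain ⟨φ, rfl, rfl, rfl, hs⟩ := h.exists_openPartialHomeomorph
  refine ⟨φ.symm, ⟨φ.open_target, φ.symm.bijOn, fun v hv => ?_⟩, φ.leftInvOn, φ.rightInvOn⟩
  have hu := φ.map_target hv
  have key : IsContactAt φ.symm (φ (φ.symm v)) := by
    refine IsContactAt.of_comp_right ?_ (h.isContactAt _ hu) ((isContactAt_id _).congr ?_)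
    · rw [φ.right_inv hv]; exact hs v hv
    · filter_upwards [φ.open_source.mem_nhds hu] with x hx using φ.left_inv hx
  rwa [φ.right_inv hv] at key

/-- Diffeomorphisms with an explicit inverse. -/
theorem of_inverse (hf : ContDiff ℝ ∞ f) (hg : ContDiff ℝ ∞ g) (hfg : Function.LeftInverse g f)
    (hgf : Function.RightInverse g f)
    (hc : ∀ u, ∃ c : ℝ, c ≠ 0 ∧ ∀ w, alphaSt (f u) (fderiv ℝ f u w) = c * alphaSt u w) :
    IsContactoOn f univ univ where
  isOpen := isOpen_univ
  bijOn := bijOn_univ.2 ⟨hfg.injective, hgf.surjective⟩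
  isContactAt u _ := by
    refine ⟨hf.contDiffAt, ?_, hc u⟩
    have hf' : Differentiable ℝ f := hf.differentiable (by simp)
    have hg' : Differentiable ℝ g := hg.differentiable (by simp)
    have h1 : fderiv ℝ (g ∘ f) u = .id ℝ _ := by rw [hfg.comp_eq_id, fderiv_id]
    have h2 : fderiv ℝ (f ∘ g) (f u) = .id ℝ _ := by
      rw [Function.RightInverse.comp_eq_id hgf, fderiv_id]
    rw [fderiv_comp _ hg'.differentiableAt hf'.differentiableAt] at h1
    rw [fderiv_comp _ hf'.differentiableAt hg'.differentiableAt, hfg u] at h2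
    exact .of_inverse h2 h1

end IsContactoOn

theorem map_ker_eq_of_comp_eq {D : ContactSpace n →L[ℝ] ContactSpace n} (hD : D.IsInvertible)
    {a b : ContactSpace n →L[ℝ] ℝ} {c : ℝ} (hc : c ≠ 0) (h : ∀ w, b (D w) = c * a w) :
    (LinearMap.ker (a : ContactSpace n →ₗ[ℝ] ℝ)).map (D : ContactSpace n →ₗ[ℝ] ContactSpace n) =
      LinearMap.ker (b : ContactSpace n →ₗ[ℝ] ℝ) := by
  ext v
  obtain ⟨w, rfl⟩ := hD.surjective v
  simp only [Submodule.mem_map, LinearMap.mem_ker, ContinuousLinearMap.coe_coe]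
  rw [h]
  constructor
  · rintro ⟨x, hx, hxw⟩
    rw [← hD.injective hxw, hx, mul_zero]
  · intro hw
    exact ⟨w, by simpa [hc] using hw, rfl⟩

theorem alphaSt_apply (u w : ContactSpace n) :
    alphaSt u w = w.2.2 + ∑ i, u.1 i * w.2.1 i := by
  simp [alphaSt, dz, dy]

theorem alphaRot_apply (u w : ContactSpace n) :
    alphaRot u w = w.2.2 + ∑ i, (u.1 i * w.2.1 i - u.2.1 i * w.1 i) := by
  simp [alphaRot, dz, dy, dx]

/-- The Reeb vector of `α_st`. -/
def reeb : ContactSpace n := (0, 0, 1)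

@[simp] theorem alphaSt_reeb (u : ContactSpace n) : alphaSt u reeb = 1 := by
  simp [alphaSt_apply, reeb]

theorem IsContactoOn.contactomorphic {f : ContactSpace n → ContactSpace n}
    {U V : Set (ContactSpace n)} (h : IsContactoOn f U V) : Contactomorphic U xiSt V xiSt := by
  obtain ⟨φ, hs, ht, rfl, hsymm⟩ := h.exists_openPartialHomeomorph
  refine ⟨φ, hs, ht, fun u hu => (h.isContactAt u hu).contDiffAt.contDiffWithinAt,
    fun v hv => (hsymm v hv).contDiffWithinAt, fun u hu => ?_⟩
  obtain ⟨c, hc, hcu⟩ := (h.isContactAt u hu).exists_factor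
  exact map_ker_eq_of_comp_eq (h.isContactAt u hu).isInvertible hc hcu

/-- Preserving hyperplanes means scaling the form: each w splits as a vector of the contact plane
plus a multiple of `reeb`, so the factor is the value of the target form on the image of `reeb`. It
is nonzero because otherwise `reeb`, by injectivity, would lie in the contact plane. -/
theorem Contactomorphic.exists_isContactoOn {U V : Set (ContactSpace n)}
    (h : Contactomorphic U xiSt V xiSt) : ∃ f, IsContactoOn f U V := by
  obtain ⟨φ, rfl, rfl, hsm, hsm', hker⟩ := h
  have hd : ∀ u ∈ φ.source, ContDiffAt ℝ ∞ φ u :=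
    fun u hu => hsm.contDiffAt (φ.open_source.mem_nhds hu)
  have hd' : ∀ v ∈ φ.target, ContDiffAt ℝ ∞ φ.symm v :=
    fun v hv => hsm'.contDiffAt (φ.open_target.mem_nhds hv)
  have hinv : ∀ u ∈ φ.source, (fderiv ℝ φ u).IsInvertible := by
    intro u hu
    have h1 : fderiv ℝ (φ.symm ∘ φ) u = .id ℝ _ := by
      rw [← fderiv_id]
      refine Filter.EventuallyEq.fderiv_eq ?_
      filter_upwards [φ.open_source.mem_nhds hu] with x hx using φ.left_inv hx
    have h2 : fderiv ℝ (φ ∘ φ.symm) (φ u) = .id ℝ _ := by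
      rw [← fderiv_id]
      refine Filter.EventuallyEq.fderiv_eq ?_
      filter_upwards [φ.open_target.mem_nhds (φ.map_source hu)] with x hx using φ.right_inv hx
    have e1 := (hd u hu).differentiableAt (by simp)
    have e2 := (hd' _ (φ.map_source hu)).differentiableAt (by simp)
    rw [fderiv_comp _ e2 e1] at h1
    rw [fderiv_comp _ (by rwa [φ.left_inv hu]) e2, φ.left_inv hu] at h2
    exact .of_inverse h2 h1
  refine ⟨φ, φ.open_source, φ.bijOn, fun u hu => ⟨hd u hu, hinv u hu, ?_⟩⟩
  have hk := hker u hu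
  have hmem : ∀ w, alphaSt u w = 0 → alphaSt (φ u) (fderiv ℝ φ u w) = 0 := by
    intro w hw
    have : fderiv ℝ φ u w ∈ xiSt (φ u) := by
      rw [← hk]; exact ⟨w, hw, rfl⟩
    exact this
  have hfac : ∀ w, alphaSt (φ u) (fderiv ℝ φ u w) =
      alphaSt (φ u) (fderiv ℝ φ u reeb) * alphaSt u w := by
    intro w
    have := hmem (w - alphaSt u w • reeb) (by simp)
    rw [map_sub, map_sub, map_smul, map_smul, smul_eq_mul] at this
    linarith
  refine ⟨_, fun h0 => ?_, hfac⟩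
  have hr : fderiv ℝ φ u reeb ∈ xiSt (φ u) := h0
  rw [← hk] at hr
  obtain ⟨w, hw, hwr⟩ := hr
  have := (hinv u hu).injective hwr
  have hw' : alphaSt u w = 0 := hw
  rw [this, alphaSt_reeb] at hw'
  exact one_ne_zero hw'

theorem contactomorphic_iff {U V : Set (ContactSpace n)} :
    Contactomorphic U xiSt V xiSt ↔ ∃ f, IsContactoOn f U V :=
  ⟨Contactomorphic.exists_isContactoOn, fun ⟨_, h⟩ => h.contactomorphic⟩

end ContactSpace

/-! ### Exhaustions and telescoping -/

/-- The stage i consists of points of norm below i whose distance to the complement of `U i` exceeds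
1/(i+1). Compact stages are where maps are made to agree; open stages are where the limit inherits
smoothness. Each stage lies in `U i` itself, where the i-th map is controlled. -/
theorem exists_compact_exhaustion_of_monotone {E : Type*} [SeminormedAddCommGroup E]
    [ProperSpace E] {U : ℕ → Set E} (hU : Monotone U) (hUo : ∀ i, IsOpen (U i)) :
    ∃ P K : ℕ → Set E, Monotone P ∧ (∀ i, IsOpen (P i)) ∧ (∀ i, IsCompact (K i)) ∧
      (∀ i, P i ⊆ K i) ∧ (∀ i, K i ⊆ U i) ∧ ⋃ i, P i = ⋃ i, U i := by
  let r : ℕ → ENNReal := fun i => ((i : ENNReal) + 1)⁻¹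
  have hr : Antitone r := fun i j hij => by
    simp only [r]
    gcongr
  have hr0 : ∀ i, 0 < r i := fun i => by simp [r]
  have hmono : ∀ x, Monotone fun i => Metric.infEDist x (U i)ᶜ := fun x i j hij =>
    Metric.infEDist_anti (compl_subset_compl.2 (hU hij))
  have hc : ∀ i, Continuous fun x => Metric.infEDist x (U i)ᶜ := fun i =>
    Metric.continuous_infEDist
  have hKU : ∀ i x, r i ≤ Metric.infEDist x (U i)ᶜ → x ∈ U i := by
    intro i x hx
    by_contra h
    rw [Metric.infEDist_zero_of_mem (show x ∈ (U i)ᶜ from h)] at hx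
    exact absurd hx (not_le.2 (hr0 i))
  refine ⟨fun i => {x | ‖x‖ < i ∧ r i < Metric.infEDist x (U i)ᶜ},
    fun i => {x | ‖x‖ ≤ i ∧ r i ≤ Metric.infEDist x (U i)ᶜ}, ?_, ?_, ?_, ?_, ?_, ?_⟩
  · rintro i j hij x ⟨h1, h2⟩
    exact ⟨h1.trans_le (by exact_mod_cast hij), (hr hij).trans_lt (h2.trans_le (hmono x hij))⟩
  · intro i
    exact (isOpen_lt continuous_norm continuous_const).inter (isOpen_lt continuous_const (hc i))
  · intro i
    refine (isCompact_closedBall (0 : E) i).of_isClosed_subset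
      ((isClosed_le continuous_norm continuous_const).inter
        (isClosed_le continuous_const (hc i))) ?_
    rintro x ⟨h1, -⟩
    simpa using h1
  · rintro i x ⟨h1, h2⟩
    exact ⟨h1.le, h2.le⟩
  · rintro i x ⟨-, h2⟩
    exact hKU i x h2
  · refine Subset.antisymm (iUnion_mono fun i x hx => hKU i x hx.2.le) (iUnion_subset fun i x hx => ?_)
    have hpos : 0 < Metric.infEDist x (U i)ᶜ := by
      rw [pos_iff_ne_zero]
      intro h0
      have := Metric.mem_closure_iff_infEDist_zero.2 h0
      rw [(hUo i).isClosed_compl.closure_eq] at this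
      exact this hx
    obtain ⟨k, hk⟩ := ENNReal.exists_inv_nat_lt hpos.ne'
    obtain ⟨l, hl⟩ := exists_nat_gt ‖x‖
    refine mem_iUnion.2 ⟨i + k + l, ?_, ?_⟩
    · refine hl.trans_le ?_
      push_cast
      have : (0 : ℝ) ≤ i + k := by positivity
      linarith
    · refine lt_of_le_of_lt ?_ (hk.trans_le (hmono x (by omega : i ≤ i + k + l)))
      simp only [r]
      gcongr
      norm_cast
      omega

namespace ContactSpace

variable {n : ℕ}

/-- Telescoping: contactomorphisms between two increasing sequences of open sets, each of which can
be corrected to extend the previous one on compact sets, can be glued. -/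
theorem exists_isContactoOn_iUnion {U V : ℕ → Set (ContactSpace n)} (hU : Monotone U)
    (hV : Monotone V) (hUo : ∀ i, IsOpen (U i)) (hVo : ∀ i, IsOpen (V i))
    (hzero : ∃ f, IsContactoOn f (U 0) (V 0))
    (hstep : ∀ i f K, IsContactoOn f (U i) (V i) → IsCompact K → K ⊆ U i →
      ∃ g, IsContactoOn g (U (i + 1)) (V (i + 1)) ∧ EqOn g f K) :
    ∃ f, IsContactoOn f (⋃ i, U i) (⋃ i, V i) := by
  classical
  obtain ⟨P, K, hP, hPo, hK, hPK, hKU, hPU⟩ := exists_compact_exhaustion_of_monotone hU hUo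
  obtain ⟨Q, D, hQ, hQo, hD, hQD, hDV, hQV⟩ := exists_compact_exhaustion_of_monotone hV hVo
  -- Agreement is imposed on a compact stage of the source and on the preimage of a compact stage of
  -- the target. The second condition is what makes the limit surjective.
  have hnext : ∀ i (f : {f // IsContactoOn f (U i) (V i)}),
      ∃ g : {g // IsContactoOn g (U (i + 1)) (V (i + 1))},
        EqOn g.1 f.1 (K i ∪ (U i ∩ f.1 ⁻¹' D i)) := by
    rintro i ⟨f, hf⟩
    obtain ⟨e, he, hinv⟩ := hf.exists_inverse
    have hcomp : U i ∩ f ⁻¹' D i = e '' D i := by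
      ext x
      constructor
      · rintro ⟨hx, hfx⟩
        exact ⟨f x, hfx, hinv.1 hx⟩
      · rintro ⟨y, hy, rfl⟩
        exact ⟨he.bijOn.mapsTo (hDV i hy), by
          rw [mem_preimage, hinv.2 (hDV i hy)]; exact hy⟩
    obtain ⟨g, hg, hgf⟩ := hstep i f (K i ∪ (U i ∩ f ⁻¹' D i)) hf
      ((hK i).union (hcomp ▸ (hD i).image_of_continuousOn (he.continuousOn.mono (hDV i))))
      (union_subset (hKU i) inter_subset_left)
    exact ⟨⟨g, hg⟩, hgf⟩
  choose next hnext using hnext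
  let F : ∀ i, {f // IsContactoOn f (U i) (V i)} :=
    fun i => Nat.rec ⟨hzero.choose, hzero.choose_spec⟩ (fun i f => next i f) i
  have hF : ∀ i, EqOn (F (i + 1)).1 (F i).1 (K i ∪ (U i ∩ (F i).1 ⁻¹' D i)) :=
    fun i => hnext i (F i)
  -- On the open set `O i` all maps from stage i onwards coincide; these sets increase because the
  -- new map agrees with the old one on each of them.
  let O : ℕ → Set (ContactSpace n) := fun i => P i ∪ (U i ∩ (F i).1 ⁻¹' Q i)
  have hOK : ∀ i, O i ⊆ K i ∪ (U i ∩ (F i).1 ⁻¹' D i) := fun i =>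
    union_subset_union (hPK i) (inter_subset_inter_right _ (preimage_mono (hQD i)))
  have hOU : ∀ i, O i ⊆ U i := fun i =>
    union_subset ((hPK i).trans (hKU i)) inter_subset_left
  have hOo : ∀ i, IsOpen (O i) := fun i =>
    (hPo i).union ((F i).2.continuousOn.isOpen_inter_preimage (hUo i) (hQo i))
  have hO : Monotone O := by
    refine monotone_nat_of_le_succ fun i => ?_
    refine union_subset_union (hP i.le_succ) ?_
    rintro x ⟨hx, hxQ⟩
    refine ⟨hU i.le_succ hx, ?_⟩
    rw [mem_preimage, hF i (Or.inr ⟨hx, hQD i hxQ⟩)]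
    exact hQ i.le_succ hxQ
  have hFij : ∀ i j, i ≤ j → EqOn (F j).1 (F i).1 (O i) := by
    intro i j hij
    induction j, hij using Nat.le_induction with
    | base => exact fun x _ => rfl
    | succ j hij ih => exact fun x hx => (hF j (hOK j (hO hij hx))).trans (ih hx)
  have hUnion : ⋃ i, O i = ⋃ i, U i :=
    Subset.antisymm (iUnion_mono hOU) (hPU ▸ iUnion_mono fun i => subset_union_left)
  let f : ContactSpace n → ContactSpace n := fun x =>
    if h : ∃ i, x ∈ O i then (F h.choose).1 x else x
  have hf : ∀ i, EqOn f (F i).1 (O i) := by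
    intro i x hx
    have h : ∃ i, x ∈ O i := ⟨i, hx⟩
    simp only [f, dif_pos h]
    rcases le_total i h.choose with hi | hi
    · exact hFij _ _ hi hx
    · exact (hFij _ _ hi h.choose_spec).symm
  refine ⟨f, isOpen_iUnion hUo, ⟨?_, ?_, ?_⟩, ?_⟩
  · rw [← hUnion]
    intro x hx
    obtain ⟨i, hi⟩ := mem_iUnion.1 hx
    rw [hf i hi]
    exact mem_iUnion.2 ⟨i, (F i).2.bijOn.mapsTo (hOU i hi)⟩
  · rw [← hUnion]
    intro x hx y hy hxy
    obtain ⟨i, hi⟩ := mem_iUnion.1 hx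
    obtain ⟨j, hj⟩ := mem_iUnion.1 hy
    have hi' := hO (le_max_left i j) hi
    have hj' := hO (le_max_right i j) hj
    rw [hf _ hi', hf _ hj'] at hxy
    exact (F _).2.bijOn.injOn (hOU _ hi') (hOU _ hj') hxy
  · rw [← hQV]
    intro y hy
    obtain ⟨i, hi⟩ := mem_iUnion.1 hy
    obtain ⟨x, hx, rfl⟩ := (F i).2.bijOn.surjOn (hDV i (hQD i hi))
    exact ⟨x, mem_iUnion.2 ⟨i, hx⟩, hf i (Or.inr ⟨hx, hi⟩)⟩
  · rw [← hUnion]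
    intro x hx
    obtain ⟨i, hi⟩ := mem_iUnion.1 hx
    exact ((F i).2.isContactAt x (hOU i hi)).congr
      ((hf i).eventuallyEq_of_mem ((hOo i).mem_nhds hi))

end ContactSpace

/-! ### Small perturbations of the identity -/

theorem ContinuousLinearMap.isInvertible_of_injective {E : Type*} [NormedAddCommGroup E]
    [NormedSpace ℝ E] [FiniteDimensional ℝ E] {D : E →L[ℝ] E} (hD : Function.Injective D) :
    D.IsInvertible :=
  ⟨(LinearEquiv.ofInjectiveEndo (D : E →ₗ[ℝ] E) hD).toContinuousLinearEquiv, by ext; rfl⟩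

/-- A `C¹`-small smooth perturbation of the identity is a diffeomorphism. -/
theorem bijective_and_isInvertible_of_fderiv_sub_id_le {E : Type*} [NormedAddCommGroup E]
    [NormedSpace ℝ E] [FiniteDimensional ℝ E] {f : E → E} (hf : Differentiable ℝ f)
    (h : ∀ x, ‖fderiv ℝ (fun y => f y - y) x‖ ≤ 1 / 2) :
    Function.Bijective f ∧ ∀ x, (fderiv ℝ f x).IsInvertible := by
  have hd : Differentiable ℝ fun y => f y - y := hf.sub differentiable_id
  -- By the mean value inequality f − id is 1/2-Lipschitz, and 1/2 < 1 = ‖id⁻¹‖⁻¹ in nonzero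
  -- dimension.
  have happ : ApproximatesLinearOn f ((ContinuousLinearEquiv.refl ℝ E : E ≃L[ℝ] E) : E →L[ℝ] E)
      univ (1 / 2) := by
    intro x _ y _
    have := convex_univ.norm_image_sub_le_of_norm_fderiv_le (𝕜 := ℝ) (fun z _ => hd z)
      (fun z _ => h z) (mem_univ y) (mem_univ x)
    have e : f x - f y - (x - y) = (f x - x) - (f y - y) := by abel
    simpa [e] using this
  have hc : Subsingleton E ∨ (1 / 2 : NNReal) <
      ‖((ContinuousLinearEquiv.refl ℝ E).symm : E →L[ℝ] E)‖₊⁻¹ := by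
    rcases subsingleton_or_nontrivial E with hE | hE
    · exact Or.inl hE
    · right
      have : ‖((ContinuousLinearEquiv.refl ℝ E).symm : E →L[ℝ] E)‖₊ = 1 := by
        ext
        simp
      rw [this]
      simp only [inv_one]
      exact NNReal.half_lt_self one_ne_zero
  refine ⟨⟨injOn_univ.1 (happ.injOn hc), happ.surjective hc⟩, fun x => ?_⟩
  apply ContinuousLinearMap.isInvertible_of_injective
  have e : fderiv ℝ (fun y => f y - y) x = fderiv ℝ f x - .id ℝ E := by
    rw [fderiv_fun_sub (hf x) differentiableAt_fun_id, fderiv_fun_id]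
  rw [injective_iff_map_eq_zero]
  intro v hv
  have h1 := (fderiv ℝ (fun y => f y - y) x).le_of_opNorm_le (h x) v
  rw [e] at h1
  simp only [sub_apply, hv, ContinuousLinearMap.id_apply, zero_sub,
    norm_neg] at h1
  rw [← norm_eq_zero]
  linarith [norm_nonneg v]

/-- If `Θ` vanishes on `E × 0` then `x ↦ Θ (x, j x)` has small derivative when `j` is `C¹`-small. -/
theorem exists_fderiv_comp_graph_le {E J F : Type*} [NormedAddCommGroup E] [NormedSpace ℝ E]
    [NormedAddCommGroup J] [NormedSpace ℝ J] [NormedAddCommGroup F] [NormedSpace ℝ F]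
    {N : Set (E × J)} (hN : IsOpen N) (hN0 : ∀ v, (v, 0) ∈ N) {Θ : E × J → F}
    (hΘ : ContDiffOn ℝ 1 Θ N) (hΘ0 : ∀ v, Θ (v, 0) = 0) {K : Set E} (hK : IsCompact K)
    {η : ℝ} (hη : 0 < η) :
    ∃ ε > 0, ∀ (j : E → J), ∀ v ∈ K, DifferentiableAt ℝ j v → ‖j v‖ ≤ ε → ‖fderiv ℝ j v‖ ≤ ε →
      (v, j v) ∈ N ∧ ‖fderiv ℝ (fun x => Θ (x, j x)) v‖ ≤ η := by
  -- The chain rule written as a function of the 1-jet of j and of the point. It is continuous and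
  -- zero at the zero jet, so compactness of K gives a uniform ε.
  let G : (J × (E →L[ℝ] J)) × E → E →L[ℝ] F := fun p =>
    (fderiv ℝ Θ (p.2, p.1.1)).comp
      (ContinuousLinearMap.inl ℝ E J + (ContinuousLinearMap.inr ℝ E J).comp p.1.2)
  have hdiff : ∀ p ∈ N, DifferentiableAt ℝ Θ p := fun p hp =>
    (hΘ.contDiffAt (hN.mem_nhds hp)).differentiableAt (by simp)
  have hpair : ∀ (j : E → J) (T : E →L[ℝ] J) (v : E), HasFDerivAt j T v →
      HasFDerivAt (fun x => (x, j x))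
        (ContinuousLinearMap.inl ℝ E J + (ContinuousLinearMap.inr ℝ E J).comp T) v := by
    intro j T v h
    have e : (ContinuousLinearMap.id ℝ E).prod T =
        ContinuousLinearMap.inl ℝ E J + (ContinuousLinearMap.inr ℝ E J).comp T := by
      ext <;> simp
    exact e ▸ (hasFDerivAt_id v).prodMk h
  have hG0 : ∀ v, G (0, v) = 0 := by
    intro v
    have h1 := hpair (fun _ => 0) 0 v (hasFDerivAt_const 0 v)
    have h2 := (hdiff (v, 0) (hN0 v)).hasFDerivAt.comp v h1
    have h3 : Θ ∘ (fun x : E => (x, (0 : J))) = fun _ => 0 := funext fun x => hΘ0 x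
    rw [h3] at h2
    exact h2.unique (hasFDerivAt_const 0 v)
  have hcont : ∀ v, ContinuousAt G (0, v) := by
    intro v
    have h1 : ContinuousAt (fderiv ℝ Θ) (v, 0) :=
      (hΘ.continuousOn_fderiv_of_isOpen hN le_rfl).continuousAt (hN.mem_nhds (hN0 v))
    have h2 : ContinuousAt (fun p : (J × (E →L[ℝ] J)) × E => (p.2, p.1.1)) (0, v) := by fun_prop
    have h3 : ContinuousAt (fun p : (J × (E →L[ℝ] J)) × E => fderiv ℝ Θ (p.2, p.1.1)) (0, v) :=
      ContinuousAt.comp (g := fderiv ℝ Θ) h1 h2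
    refine h3.clm_comp ?_
    fun_prop
  have hev : ∀ᶠ q in 𝓝 (0 : J × (E →L[ℝ] J)), ∀ v ∈ K, (v, q.1) ∈ N ∧ ‖G (q, v)‖ < η := by
    refine hK.eventually_forall_of_forall_eventually fun v _ => ?_
    refine Filter.Eventually.and ?_ ?_
    · exact ContinuousAt.eventually_mem (f := fun p : (J × (E →L[ℝ] J)) × E => (p.2, p.1.1))
        (by fun_prop) (hN.mem_nhds (hN0 v))
    · refine (hcont v).norm.eventually_lt continuousAt_const ?_
      rw [hG0, norm_zero]
      exact hη
  obtain ⟨ε, hε, hball⟩ := Metric.nhds_basis_closedBall.eventually_iff.1 hev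
  refine ⟨ε, hε, fun j v hv hj h1 h2 => ?_⟩
  have hmem : (j v, fderiv ℝ j v) ∈ Metric.closedBall (0 : J × (E →L[ℝ] J)) ε := by
    rw [mem_closedBall_zero_iff, Prod.norm_def]
    exact max_le h1 h2
  obtain ⟨h3, h4⟩ := hball hmem v hv
  refine ⟨h3, ?_⟩
  have h5 := hpair j _ v hj.hasFDerivAt
  have h6 := (hdiff (v, j v) h3).hasFDerivAt.comp v h5
  have h7 : fderiv ℝ (fun x => Θ (x, j x)) v = G ((j v, fderiv ℝ j v), v) := h6.fderiv
  rw [h7]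
  exact h4.le

/-! ### Generating functions -/

namespace ContactSpace

variable {n : ℕ}

/-- The vector `∂/∂xᵢ`. -/
def ex (i : Fin n) : ContactSpace n := (Pi.single i 1, 0, 0)

/-- The vector `∂/∂yᵢ`. -/
def ey (i : Fin n) : ContactSpace n := (0, Pi.single i 1, 0)

theorem clm_apply_eq (l : ContactSpace n →L[ℝ] ℝ) (w : ContactSpace n) :
    l w = ∑ i, w.1 i * l (ex i) + ∑ i, w.2.1 i * l (ey i) + w.2.2 * l reeb := by
  have h : w = ∑ i, w.1 i • ex i + ∑ i, w.2.1 i • ey i + w.2.2 • (reeb : ContactSpace n) := by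
    refine Prod.ext ?_ (Prod.ext ?_ ?_)
    · ext k
      simp [ex, ey, reeb, Prod.fst_sum, Pi.single_apply]
    · ext k
      simp [ex, ey, reeb, Prod.fst_sum, Prod.snd_sum, Pi.single_apply]
    · simp [ex, ey, reeb, Prod.snd_sum]
  conv_lhs => rw [h]
  simp

theorem fderiv_apply_snd_snd {f : ContactSpace n → ContactSpace n} {v : ContactSpace n}
    (hf : DifferentiableAt ℝ f v) (w : ContactSpace n) :
    (fderiv ℝ f v w).2.2 = fderiv ℝ (fun u => (f u).2.2) v w := by
  have := ((dz (n := n)).hasFDerivAt.comp v hf.hasFDerivAt).fderiv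
  exact (congrArg (fun L => L w) this).symm

theorem fderiv_apply_snd_fst {f : ContactSpace n → ContactSpace n} {v : ContactSpace n}
    (hf : DifferentiableAt ℝ f v) (w : ContactSpace n) (i : Fin n) :
    (fderiv ℝ f v w).2.1 i = fderiv ℝ (fun u => (f u).2.1 i) v w := by
  have := ((dy (n := n) i).hasFDerivAt.comp v hf.hasFDerivAt).fderiv
  exact (congrArg (fun L => L w) this).symm

theorem fderiv_apply_fst {f : ContactSpace n → ContactSpace n} {v : ContactSpace n}
    (hf : DifferentiableAt ℝ f v) (w : ContactSpace n) (i : Fin n) :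
    (fderiv ℝ f v w).1 i = fderiv ℝ (fun u => (f u).1 i) v w := by
  have := ((dx (n := n) i).hasFDerivAt.comp v hf.hasFDerivAt).fderiv
  exact (congrArg (fun L => L w) this).symm

@[simp] theorem fderiv_snd_snd (v w : ContactSpace n) :
    fderiv ℝ (fun u : ContactSpace n => u.2.2) v w = w.2.2 :=
  congrArg (fun L => L w) (dz (n := n)).fderiv

@[simp] theorem fderiv_snd_fst (v w : ContactSpace n) (i : Fin n) :
    fderiv ℝ (fun u : ContactSpace n => u.2.1 i) v w = w.2.1 i :=
  congrArg (fun L => L w) (dy (n := n) i).fderiv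

@[simp] theorem fderiv_fst_apply (v w : ContactSpace n) (i : Fin n) :
    fderiv ℝ (fun u : ContactSpace n => u.1 i) v w = w.1 i :=
  congrArg (fun L => L w) (dx (n := n) i).fderiv

/-- The source point `(x, y, z)` of the contact transformation with generating function `S` at
`v = (X, y, z)`, where `l = dS(v)`. -/
def genSource (v : ContactSpace n) (l : ContactSpace n →L[ℝ] ℝ) : ContactSpace n :=
  ((1 + l reeb)⁻¹ • (v.1 + fun i => l (ey i)), v.2.1, v.2.2)

/-- The target point `(X, Y, Z)` of the contact transformation with generating function `S` at
`v = (X, y, z)`, where `s = S(v)` and `l = dS(v)`. -/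
def genTarget (v : ContactSpace n) (s : ℝ) (l : ContactSpace n →L[ℝ] ℝ) : ContactSpace n :=
  (v.1, v.2.1 + fun i => l (ex i), v.2.2 + s - ∑ i, v.1 i * l (ex i))

theorem contDiffAt_genSource {F : Type*} [NormedAddCommGroup F]
    [NormedSpace ℝ F] {a : F → ContactSpace n} {l : F → ContactSpace n →L[ℝ] ℝ} {x : F}
    {m : WithTop ℕ∞} (ha : ContDiffAt ℝ m a x) (hl : ContDiffAt ℝ m l x)
    (h0 : 1 + l x reeb ≠ 0) : ContDiffAt ℝ m (fun y => genSource (a y) (l y)) x := by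
  have h1 : ∀ c, ContDiffAt ℝ m (fun y => l y c) x := fun c => hl.clm_apply contDiffAt_const
  refine ContDiffAt.prodMk (ContDiffAt.smul ((contDiffAt_const.add (h1 _)).inv h0)
    (ha.fst.add ?_)) ha.snd
  exact contDiffAt_pi.2 fun i => h1 _

theorem contDiffAt_genTarget {F : Type*} [NormedAddCommGroup F]
    [NormedSpace ℝ F] {a : F → ContactSpace n} {s : F → ℝ} {l : F → ContactSpace n →L[ℝ] ℝ} {x : F}
    {m : WithTop ℕ∞} (ha : ContDiffAt ℝ m a x) (hs : ContDiffAt ℝ m s x)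
    (hl : ContDiffAt ℝ m l x) : ContDiffAt ℝ m (fun y => genTarget (a y) (s y) (l y)) x := by
  have h1 : ∀ c, ContDiffAt ℝ m (fun y => l y c) x := fun c => hl.clm_apply contDiffAt_const
  refine ContDiffAt.prodMk ha.fst (ContDiffAt.prodMk (ha.snd.fst.add ?_)
    ((ha.snd.snd.add hs).sub (ContDiffAt.sum fun i _ => ContDiffAt.mul ?_ (h1 _))))
  · exact contDiffAt_pi.2 fun i => h1 _
  · exact contDiffAt_pi.1 ha.fst i

/-- The source and target maps of a generating function pull `α_st` back to proportional forms. -/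
theorem alphaSt_genTarget_eq {S : ContactSpace n → ℝ} {v : ContactSpace n}
    (hS : ContDiffAt ℝ ∞ S v) (h0 : 1 + fderiv ℝ S v reeb ≠ 0) (w : ContactSpace n) :
    alphaSt (genTarget v (S v) (fderiv ℝ S v))
        (fderiv ℝ (fun u => genTarget u (S u) (fderiv ℝ S u)) v w) =
      (1 + fderiv ℝ S v reeb) * alphaSt (genSource v (fderiv ℝ S v))
        (fderiv ℝ (fun u => genSource u (fderiv ℝ S u)) v w) := by
  have hS' : ContDiffAt ℝ ∞ (fderiv ℝ S) v := hS.fderiv_right (by simp)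
  have hdS : DifferentiableAt ℝ S v := hS.differentiableAt (by simp)
  have hA : DifferentiableAt ℝ (fun u => genSource u (fderiv ℝ S u)) v :=
    (contDiffAt_genSource contDiffAt_id hS' h0).differentiableAt (by simp)
  have hB : DifferentiableAt ℝ (fun u => genTarget u (S u) (fderiv ℝ S u)) v :=
    (contDiffAt_genTarget contDiffAt_id hS hS').differentiableAt (by simp)
  have hc : ∀ c, DifferentiableAt ℝ (fun u => fderiv ℝ S u c) v := fun c =>
    (hS'.differentiableAt (by simp)).clm_apply (differentiableAt_const c)
  rw [alphaSt_apply, alphaSt_apply, fderiv_apply_snd_snd hA, fderiv_apply_snd_snd hB]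
  simp only [fderiv_apply_snd_fst hA, fderiv_apply_snd_fst hB]
  simp only [genSource, genTarget, fderiv_snd_snd, fderiv_snd_fst, Pi.add_apply, Pi.smul_apply,
    smul_eq_mul]
  have e1 : ∀ i, fderiv ℝ (fun u : ContactSpace n => u.2.1 i + fderiv ℝ S u (ex i)) v w =
      w.2.1 i + fderiv ℝ (fun u => fderiv ℝ S u (ex i)) v w := by
    intro i
    rw [fderiv_fun_add (by fun_prop) (hc _)]
    simp
  have e2 : fderiv ℝ (fun u : ContactSpace n => u.2.2 + S u - ∑ i, u.1 i * fderiv ℝ S u (ex i)) v w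
      = w.2.2 + fderiv ℝ S v w - ∑ i, (v.1 i * fderiv ℝ (fun u => fderiv ℝ S u (ex i)) v w +
        w.1 i * fderiv ℝ S v (ex i)) := by
    have hm : ∀ i, DifferentiableAt ℝ (fun u : ContactSpace n => u.1 i * fderiv ℝ S u (ex i)) v :=
      fun i => DifferentiableAt.fun_mul (by fun_prop) (hc _)
    rw [fderiv_fun_sub (DifferentiableAt.fun_add (by fun_prop) hdS)
      (DifferentiableAt.fun_sum fun i _ => hm i), fderiv_fun_add (by fun_prop) hdS,
      fderiv_fun_sum fun i _ => hm i]
    simp only [sub_apply, add_apply, fderiv_snd_snd,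
      sum_apply]
    congr 1
    refine Finset.sum_congr rfl fun i _ => ?_
    rw [fderiv_fun_mul (by fun_prop) (hc _)]
    simp
    ring
  rw [e2, clm_apply_eq (fderiv ℝ S v) w]
  simp only [e1, mul_add, Finset.mul_sum, Finset.sum_add_distrib, add_mul]
  have e3 : ∀ i, fderiv ℝ S v reeb * ((1 + fderiv ℝ S v reeb)⁻¹ * (v.1 i) * w.2.1 i) =
    v.1 i * w.2.1 i - (1 + fderiv ℝ S v reeb)⁻¹ * v.1 i * w.2.1 i := by
    intro i; field_simp; ring
  have e4 : ∀ i, fderiv ℝ S v reeb * ((1 + fderiv ℝ S v reeb)⁻¹ * (fderiv ℝ S v (ey i)) * w.2.1 i) =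
    w.2.1 i * fderiv ℝ S v (ey i) -
      (1 + fderiv ℝ S v reeb)⁻¹ * fderiv ℝ S v (ey i) * w.2.1 i := by
    intro i; field_simp; ring
  simp only [e3, e4, Finset.sum_sub_distrib]
  ring_nf

@[simp] theorem genSource_zero (v : ContactSpace n) : genSource v 0 = v := by
  refine Prod.ext ?_ rfl
  ext i
  simp [genSource]

@[simp] theorem genTarget_zero (v : ContactSpace n) : genTarget v 0 0 = v := by
  refine Prod.ext rfl (Prod.ext ?_ ?_)
  · ext i
    simp [genTarget]
  · simp [genTarget]

/-- A function whose source and target maps are global diffeomorphisms generates a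
contactomorphism. -/
theorem exists_isContactoOn_of_generating {S : ContactSpace n → ℝ} (hS : ContDiff ℝ ∞ S)
    (h0 : ∀ v, 1 + fderiv ℝ S v reeb ≠ 0)
    (hA : ∀ v, ‖fderiv ℝ (fun u => genSource u (fderiv ℝ S u) - u) v‖ ≤ 1 / 2)
    (hB : ∀ v, ‖fderiv ℝ (fun u => genTarget u (S u) (fderiv ℝ S u) - u) v‖ ≤ 1 / 2) :
    ∃ F, IsContactoOn F univ univ ∧
      ∀ v, F (genSource v (fderiv ℝ S v)) = genTarget v (S v) (fderiv ℝ S v) := by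
  have hS' : ContDiff ℝ ∞ (fderiv ℝ S) := hS.fderiv_right (by simp)
  set A := fun u => genSource u (fderiv ℝ S u)
  set B := fun u => genTarget u (S u) (fderiv ℝ S u)
  have hAs : ContDiff ℝ ∞ A := contDiff_iff_contDiffAt.2 fun v =>
    contDiffAt_genSource contDiffAt_id hS'.contDiffAt (h0 v)
  have hBs : ContDiff ℝ ∞ B := contDiff_iff_contDiffAt.2 fun v =>
    contDiffAt_genTarget contDiffAt_id hS.contDiffAt hS'.contDiffAt
  obtain ⟨hAb, hAi⟩ := bijective_and_isInvertible_of_fderiv_sub_id_le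
    (hAs.differentiable (by simp)) hA
  obtain ⟨hBb, hBi⟩ := bijective_and_isInvertible_of_fderiv_sub_id_le
    (hBs.differentiable (by simp)) hB
  obtain ⟨φ, hφs, hφt, hφ, hφsymm⟩ := exists_openPartialHomeomorph_of_isInvertible_fderiv
    isOpen_univ hAb.injective.injOn (fun u _ => hAs.contDiffAt) (fun u _ => hAi u)
  rw [image_univ, hAb.surjective.range_eq] at hφt hφsymm
  have hl : ∀ v, φ.symm (A v) = v := fun v => by
    rw [← hφ]; exact φ.left_inv (hφs ▸ mem_univ v)
  have hr : ∀ u, A (φ.symm u) = u := fun u => by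
    rw [← hφ]; exact φ.right_inv (hφt ▸ mem_univ u)
  -- The contactomorphism is B ∘ A⁻¹; A and B pull the standard form back to forms differing by the
  -- factor 1 + S_z.
  have hcomp : (B ∘ φ.symm) ∘ A = B := funext fun v => by simp [hl]
  refine ⟨B ∘ φ.symm, ⟨isOpen_univ, bijOn_univ.2 (hBb.comp ?_), fun u _ => ?_⟩,
    fun v => congrFun hcomp v⟩
  · exact ⟨fun a b hab => by rw [← hr a, ← hr b, hab], fun v => ⟨A v, hl v⟩⟩
  · have hF : ContDiffAt ℝ ∞ (B ∘ φ.symm) u := hBs.contDiffAt.comp u (hφsymm u (mem_univ u))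
    obtain ⟨v, rfl⟩ := hAb.surjective u
    have hchain : (fderiv ℝ (B ∘ φ.symm) (A v)).comp (fderiv ℝ A v) = fderiv ℝ B v := by
      rw [← fderiv_comp v (hF.differentiableAt (by simp)) (hAs.differentiable (by simp) v), hcomp]
    refine ⟨hF, ?_, 1 + fderiv ℝ S v reeb, h0 v, fun w => ?_⟩
    · have := hBi v
      rw [← hchain] at this
      obtain ⟨D, hD⟩ := hAi v
      rwa [← hD, ContinuousLinearMap.isInvertible_comp_equiv] at this
    · obtain ⟨w, rfl⟩ := (hAi v).surjective w
      have hw : fderiv ℝ (B ∘ φ.symm) (A v) (fderiv ℝ A v w) = fderiv ℝ B v w := by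
        rw [← hchain]; rfl
      rw [hw, Function.comp_apply, hl]
      exact alphaSt_genTarget_eq hS.contDiffAt (h0 v) w

/-- Cutting off a `C²`-small generating function gives a global contactomorphism. -/
theorem exists_isContactoOn_of_cutoff {χ : ContactSpace n → ℝ} (hχ : ContDiff ℝ ∞ χ)
    (hc : HasCompactSupport χ) :
    ∃ ε > 0, ∀ (S : ContactSpace n → ℝ) (O : Set (ContactSpace n)), IsOpen O → tsupport χ ⊆ O →
      ContDiffOn ℝ ∞ S O →
      (∀ v ∈ tsupport χ, ‖S v‖ ≤ ε ∧ ‖fderiv ℝ S v‖ ≤ ε ∧ ‖fderiv ℝ (fderiv ℝ S) v‖ ≤ ε) →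
      ∃ F, IsContactoOn F univ univ ∧ (∀ u ∉ tsupport χ, F u = u) ∧
        ∀ v, χ =ᶠ[𝓝 v] 1 →
          F (genSource v (fderiv ℝ S v)) = genTarget v (S v) (fderiv ℝ S v) := by
  let J := ℝ × (ContactSpace n →L[ℝ] ℝ)
  have hχ' : ContDiff ℝ ∞ (fderiv ℝ χ) := hχ.fderiv_right (by simp)
  -- The 1-jet of χ · S, expressed through the 1-jet (value, derivative) of S; the 2-jet bound on S
  -- is then a C¹ bound on the graph function j below.
  let l : ContactSpace n × J → ContactSpace n →L[ℝ] ℝ := fun p =>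
    χ p.1 • p.2.2 + p.2.1 • fderiv ℝ χ p.1
  let s : ContactSpace n × J → ℝ := fun p => χ p.1 * p.2.1
  have hls : ContDiff ℝ ∞ l := by
    refine ContDiff.add ((hχ.comp contDiff_fst).smul contDiff_snd.snd)
      (ContDiff.smul contDiff_snd.fst (hχ'.comp contDiff_fst))
  have hss : ContDiff ℝ ∞ s := (hχ.comp contDiff_fst).mul contDiff_snd.fst
  let N : Set (ContactSpace n × J) := {p | 1 + l p reeb ≠ 0}
  have hN : IsOpen N := by
    refine isOpen_ne_fun ?_ continuous_const
    exact continuous_const.add (hls.continuous.clm_apply continuous_const)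
  have hl0 : ∀ v, l (v, 0) = 0 := fun v => by simp [l]
  have hs0 : ∀ v, s (v, 0) = 0 := fun v => by simp [s]
  have hN0 : ∀ v, ((v, 0) : ContactSpace n × J) ∈ N := fun v => by
    simp [N, hl0]
  have hΘA : ContDiffOn ℝ 1 (fun p : ContactSpace n × J => genSource p.1 (l p) - p.1) N :=
    fun p hp => ((contDiffAt_genSource contDiffAt_fst (hls.contDiffAt.of_le (by simp)) hp).sub
      contDiffAt_fst).contDiffWithinAt
  have hΘB : ContDiffOn ℝ 1 (fun p : ContactSpace n × J => genTarget p.1 (s p) (l p) - p.1) N :=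
    fun p hp => ((contDiffAt_genTarget contDiffAt_fst (hss.contDiffAt.of_le (by simp))
      (hls.contDiffAt.of_le (by simp))).sub contDiffAt_fst).contDiffWithinAt
  obtain ⟨ε₁, hε₁, h₁⟩ := exists_fderiv_comp_graph_le hN hN0 hΘA (fun v => by simp [hl0]) hc.isCompact
    (show (0 : ℝ) < 1 / 2 by norm_num)
  obtain ⟨ε₂, hε₂, h₂⟩ := exists_fderiv_comp_graph_le hN hN0 hΘB (fun v => by simp [hl0, hs0])
    hc.isCompact (show (0 : ℝ) < 1 / 2 by norm_num)
  refine ⟨min ε₁ ε₂, lt_min hε₁ hε₂, fun S O hO hχO hS hsmall => ?_⟩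
  have hSat : ∀ v ∈ O, ContDiffAt ℝ ∞ S v := fun v hv => hS.contDiffAt (hO.mem_nhds hv)
  let T : ContactSpace n → ℝ := fun v => χ v * S v
  let j : ContactSpace n → J := fun v => (S v, fderiv ℝ S v)
  have hTout : ∀ v ∉ tsupport χ, T =ᶠ[𝓝 v] 0 := fun v hv => by
    filter_upwards [notMem_tsupport_iff_eventuallyEq.1 hv] with u hu
    simp [T, hu]
  have hz : fderiv ℝ (0 : ContactSpace n → ℝ) = 0 := funext fun v => fderiv_const_apply 0
  have hTin : ∀ v ∈ O, fderiv ℝ T v = l (v, j v) := fun v hv => by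
    simp only [T, l, j]
    rw [fderiv_fun_mul (hχ.differentiable (by simp) v) ((hSat v hv).differentiableAt (by simp))]
  have hTs : ContDiff ℝ ∞ T := by
    refine contDiff_iff_contDiffAt.2 fun v => ?_
    by_cases hv : v ∈ tsupport χ
    · exact hχ.contDiffAt.mul (hSat v (hχO hv))
    · exact contDiffAt_const.congr_of_eventuallyEq (hTout v hv)
  have hj : ∀ v ∈ tsupport χ, DifferentiableAt ℝ j v ∧ ‖j v‖ ≤ min ε₁ ε₂ ∧
      ‖fderiv ℝ j v‖ ≤ min ε₁ ε₂ := by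
    intro v hv
    obtain ⟨a, b, c⟩ := hsmall v hv
    have d1 : DifferentiableAt ℝ S v := (hSat v (hχO hv)).differentiableAt (by simp)
    have d2 : DifferentiableAt ℝ (fderiv ℝ S) v :=
      ((hSat v (hχO hv)).fderiv_right (m := ∞) (by simp)).differentiableAt (by simp)
    have d3 := d1.hasFDerivAt.prodMk d2.hasFDerivAt
    refine ⟨d3.differentiableAt, ?_, ?_⟩
    · rw [Prod.norm_def]; exact max_le a b
    · rw [show fderiv ℝ j v = _ from d3.fderiv, ContinuousLinearMap.opNorm_prod, Prod.norm_def]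
      exact max_le b c
  have hA : ∀ v, 1 + fderiv ℝ T v reeb ≠ 0 ∧
      ‖fderiv ℝ (fun u => genSource u (fderiv ℝ T u) - u) v‖ ≤ 1 / 2 := by
    intro v
    by_cases hv : v ∈ tsupport χ
    · obtain ⟨a, b, c⟩ := hj v hv
      obtain ⟨h3, h4⟩ := h₁ j v hv a (b.trans (min_le_left _ _)) (c.trans (min_le_left _ _))
      refine ⟨by rw [hTin v (hχO hv)]; exact h3, ?_⟩
      rwa [Filter.EventuallyEq.fderiv_eq (f := fun x => genSource x (l (x, j x)) - x)]
      filter_upwards [hO.mem_nhds (hχO hv)] with u hu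
      rw [hTin u hu]
    · have h3 := (hTout v hv).fderiv (𝕜 := ℝ)
      rw [hz] at h3
      refine ⟨by rw [h3.eq_of_nhds]; simp, ?_⟩
      rw [Filter.EventuallyEq.fderiv_eq (f := fun _ => (0 : ContactSpace n))]
      · rw [fderiv_const_apply, norm_zero]; norm_num
      · filter_upwards [h3] with u hu
        simp [hu]
  have hB : ∀ v, ‖fderiv ℝ (fun u => genTarget u (T u) (fderiv ℝ T u) - u) v‖ ≤ 1 / 2 := by
    intro v
    by_cases hv : v ∈ tsupport χ
    · obtain ⟨a, b, c⟩ := hj v hv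
      obtain ⟨h3, h4⟩ := h₂ j v hv a (b.trans (min_le_right _ _)) (c.trans (min_le_right _ _))
      rwa [Filter.EventuallyEq.fderiv_eq
        (f := fun x => genTarget x (s (x, j x)) (l (x, j x)) - x)]
      filter_upwards [hO.mem_nhds (hχO hv)] with u hu
      rw [hTin u hu]
    · have h3 := (hTout v hv).fderiv (𝕜 := ℝ)
      rw [hz] at h3
      rw [Filter.EventuallyEq.fderiv_eq (f := fun _ => (0 : ContactSpace n))]
      · rw [fderiv_const_apply, norm_zero]; norm_num
      · filter_upwards [h3, hTout v hv] with u hu hu'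
        simp [hu, hu']
  obtain ⟨F, hF, hFAB⟩ := exists_isContactoOn_of_generating hTs (fun v => (hA v).1)
    (fun v => (hA v).2) hB
  refine ⟨F, hF, fun u hu => ?_, fun v hv => ?_⟩
  · have h1 : T u = 0 := (hTout u hu).eq_of_nhds
    have h2 : fderiv ℝ T u = 0 := by rw [(hTout u hu).fderiv_eq, hz]; rfl
    have := hFAB u
    rwa [h1, h2, genSource_zero, genTarget_zero] at this
  · have h1 : T =ᶠ[𝓝 v] S := by
      filter_upwards [hv] with u hu
      simp [T, hu]
    have := hFAB v
    rwa [h1.fderiv_eq, h1.eq_of_nhds] at this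

end ContactSpace

/-! ### Cut-off contact dilations -/

theorem exists_contDiff_cutoff {E : Type*} [NormedAddCommGroup E] [NormedSpace ℝ E]
    [FiniteDimensional ℝ E] {C V : Set E} (hC : IsCompact C) (hV : IsOpen V) (hCV : C ⊆ V) :
    ∃ χ : E → ℝ, ContDiff ℝ ∞ χ ∧ HasCompactSupport χ ∧ tsupport χ ⊆ V ∧
      ∃ W, IsOpen W ∧ C ⊆ W ∧ ∀ u ∈ W, χ =ᶠ[𝓝 u] 1 := by
  have : ProperSpace E := FiniteDimensional.proper_real E
  obtain ⟨L, hL, hCL, hLV⟩ := exists_compact_between hC hV hCV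
  obtain ⟨f, hf1, hf0, -⟩ := exists_contMDiffMap_one_nhds_of_subset_interior (n := (⊤ : ℕ∞))
    (modelWithCornersSelf ℝ E) hC.isClosed hCL
  have hsub : tsupport f ⊆ L := closure_minimal (fun x hx => by
    by_contra h
    exact hx (hf0 x h)) hL.isClosed
  refine ⟨f, f.contMDiff.contDiff, hL.of_isClosed_subset (isClosed_tsupport _) hsub,
    hsub.trans hLV, ?_⟩
  obtain ⟨W, hW, hCW, hWf⟩ := mem_nhdsSet_iff_exists.1 hf1
  exact ⟨W, hW, hCW, fun u hu => by
    filter_upwards [hW.mem_nhds hu] with x hx using hWf hx⟩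

namespace ContactSpace

variable {n : ℕ}

/-- The contact dilation `(x, y, z) ↦ (t x, t y, t² z)`. -/
def dil (t : ℝ) : ContactSpace n →L[ℝ] ContactSpace n :=
  (t • ContinuousLinearMap.fst ℝ _ _).prod
    ((t • (ContinuousLinearMap.fst ℝ _ _).comp (ContinuousLinearMap.snd ℝ _ _)).prod (t ^ 2 • dz))

theorem dil_apply (t : ℝ) (u : ContactSpace n) :
    dil t u = (t • u.1, t • u.2.1, t ^ 2 * u.2.2) := rfl

theorem dil_dil (s t : ℝ) (u : ContactSpace n) : dil s (dil t u) = dil (s * t) u := by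
  simp only [dil_apply, smul_smul, Prod.mk.injEq, true_and]
  ring

@[simp] theorem dil_one (u : ContactSpace n) : dil 1 u = u := by simp [dil_apply]

theorem continuous_dil : Continuous fun p : ℝ × ContactSpace n => dil p.1 p.2 := by
  simp only [dil_apply]
  fun_prop

theorem isContactoOn_dil {t : ℝ} (ht : t ≠ 0) :
    IsContactoOn (dil t : ContactSpace n → ContactSpace n) univ univ := by
  refine .of_inverse (g := dil t⁻¹) (dil t).contDiff (dil t⁻¹).contDiff
    (fun u => by simp [dil_dil, ht]) (fun u => by simp [dil_dil, ht])
    fun u => ⟨t ^ 2, pow_ne_zero 2 ht, fun w => ?_⟩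
  rw [ContinuousLinearMap.fderiv, alphaSt_apply, alphaSt_apply]
  simp only [dil_apply, Pi.smul_apply, smul_eq_mul, mul_add, Finset.mul_sum]
  congr 1
  exact Finset.sum_congr rfl fun i _ => by ring

theorem isContactoOn_iterate {c : ContactSpace n → ContactSpace n} (hc : IsContactoOn c univ univ)
    (k : ℕ) : IsContactoOn c^[k] univ univ := by
  induction k with
  | zero => exact .id isOpen_univ
  | succ k ih => rw [Function.iterate_succ]; exact ih.comp hc

/-- The generating function of `dil (1 - τ)`. -/
def dilGen (τ : ℝ) (v : ContactSpace n) : ℝ :=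
  -τ * ∑ i, v.1 i * v.2.1 i + ((1 - τ) ^ 2 - 1) * v.2.2

theorem contDiff_sum_mul : ContDiff ℝ ∞ fun v : ContactSpace n => ∑ i, v.1 i * v.2.1 i := by
  fun_prop

theorem fderiv_sum_mul (v w : ContactSpace n) :
    fderiv ℝ (fun v : ContactSpace n => ∑ i, v.1 i * v.2.1 i) v w =
      ∑ i, (v.1 i * w.2.1 i + v.2.1 i * w.1 i) := by
  rw [fderiv_fun_sum fun i _ => by fun_prop]
  simp only [sum_apply]
  refine Finset.sum_congr rfl fun i _ => ?_
  rw [fderiv_fun_mul (by fun_prop) (by fun_prop)]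
  simp

theorem fderiv_dilGen (τ : ℝ) : fderiv ℝ (dilGen (n := n) τ) = fun v =>
    (-τ) • fderiv ℝ (fun v : ContactSpace n => ∑ i, v.1 i * v.2.1 i) v +
      ((1 - τ) ^ 2 - 1) • dz := by
  ext1 v
  have h1 := (contDiff_sum_mul (n := n)).differentiable (by simp) v
  exact ((h1.hasFDerivAt.const_mul (-τ)).add
    ((dz (n := n)).hasFDerivAt.const_mul ((1 - τ) ^ 2 - 1))).fderiv

/-- For τ = 1 − s the function is (s − 1) ∑ Xᵢ yᵢ + (s² − 1) z, so X + S_y = s X and 1 + S_z = s²;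
the source of X = s x therefore has first coordinate x. -/
theorem genSource_dilGen {s : ℝ} (hs : s ≠ 0) (u : ContactSpace n) :
    genSource (s • u.1, u.2) (fderiv ℝ (dilGen (1 - s)) (s • u.1, u.2)) = u := by
  rw [fderiv_dilGen]
  refine Prod.ext ?_ rfl
  ext i
  simp [genSource, fderiv_sum_mul, dz, ey, reeb, Pi.single_apply]
  field_simp
  ring

theorem genTarget_dilGen (s : ℝ) (u : ContactSpace n) :
    genTarget (s • u.1, u.2) (dilGen (1 - s) (s • u.1, u.2))
      (fderiv ℝ (dilGen (1 - s)) (s • u.1, u.2)) = dil s u := by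
  rw [fderiv_dilGen]
  refine Prod.ext rfl (Prod.ext ?_ ?_)
  · ext i
    simp [genTarget, fderiv_sum_mul, dz, ex, Pi.single_apply, dil_apply]
    ring
  · simp [genTarget, fderiv_sum_mul, dz, ex, Pi.single_apply, dil_apply, dilGen, Finset.mul_sum]
    have : ∀ i, s * u.1 i * ((s - 1) * u.2.1 i) = (s - 1) * (s * u.1 i * u.2.1 i) := fun i => by ring
    simp only [this]
    ring

/-- In an open set which is star-shaped for the contact dilations, any contact dilation can be
cut off outside of a compact set. -/
theorem exists_compactly_supported_dil {V C : Set (ContactSpace n)} (hV : IsOpen V) (h0 : 0 ∈ V)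
    (hstar : ∀ u ∈ V, ∀ t, 0 < t → t ≤ 1 → dil t u ∈ V) (hC : IsCompact C) (hCV : C ⊆ V)
    {σ : ℝ} (hσ : 0 < σ) (hσ1 : σ < 1) :
    ∃ c, IsContactoOn c univ univ ∧ (∃ K, IsCompact K ∧ K ⊆ V ∧ ∀ u ∉ K, c u = u) ∧
      ∀ u ∈ C, c u = dil σ u := by
  -- Saturating C under dilations gives a set stable under iteration; including t = 0 keeps it
  -- compact.
  set C' : Set (ContactSpace n) := (fun p : ℝ × ContactSpace n => dil p.1 p.2) '' (Icc 0 1 ×ˢ C)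
  have hC' : IsCompact C' := (isCompact_Icc.prod hC).image continuous_dil
  have hCC' : C ⊆ C' := fun u hu => ⟨(1, u), ⟨by simp, hu⟩, by simp⟩
  have hC'V : C' ⊆ V := by
    rintro _ ⟨⟨t, u⟩, ⟨ht, hu⟩, rfl⟩
    rcases ht.1.eq_or_lt with h | h
    · simp only at h
      subst h
      have : dil 0 u = 0 := by simp [dil_apply]
      simpa [this] using h0
    · exact hstar u (hCV hu) t h ht.2
  have hC'star : ∀ s ∈ Icc (0 : ℝ) 1, ∀ u ∈ C', dil s u ∈ C' := by
    rintro s hs _ ⟨⟨t, u⟩, ⟨ht, hu⟩, rfl⟩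
    exact ⟨(s * t, u), ⟨⟨mul_nonneg hs.1 ht.1, mul_le_one₀ hs.2 ht.1 ht.2⟩, hu⟩,
      (dil_dil _ _ _).symm⟩
  obtain ⟨χ, hχ, hχc, hχV, W, hW, hCW, hχW⟩ := exists_contDiff_cutoff hC' hV hC'V
  obtain ⟨ε, hε, hgen⟩ := exists_isContactoOn_of_cutoff hχ hχc
  have hq := contDiff_sum_mul (n := n)
  have hq1 : ContDiff ℝ ∞ (fderiv ℝ fun v : ContactSpace n => ∑ i, v.1 i * v.2.1 i) :=
    hq.fderiv_right (by simp)
  have hq2 : ContDiff ℝ ∞ (fderiv ℝ (fderiv ℝ fun v : ContactSpace n => ∑ i, v.1 i * v.2.1 i)) :=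
    hq1.fderiv_right (by simp)
  have hdd : ∀ τ v, fderiv ℝ (fderiv ℝ (dilGen (n := n) τ)) v =
      (-τ) • fderiv ℝ (fderiv ℝ fun v : ContactSpace n => ∑ i, v.1 i * v.2.1 i) v := by
    intro τ v
    rw [fderiv_dilGen]
    exact (((hq1.differentiable (by simp) v).hasFDerivAt.const_smul (-τ)).add_const _).fderiv
  have hsmall : ∀ᶠ τ in 𝓝 (0 : ℝ), ∀ v ∈ tsupport χ, ‖dilGen τ v‖ ≤ ε ∧
      ‖fderiv ℝ (dilGen τ) v‖ ≤ ε ∧ ‖fderiv ℝ (fderiv ℝ (dilGen τ)) v‖ ≤ ε := by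
    refine hχc.isCompact.eventually_forall_of_forall_eventually fun v _ => ?_
    have key : ∀ {F : Type} [NormedAddCommGroup F] (f : ℝ × ContactSpace n → F),
        Continuous f → f (0, v) = 0 → ∀ᶠ p in 𝓝 (0, v), ‖f p‖ ≤ ε := by
      intro F _ f hf hf0
      have : ∀ᶠ p in 𝓝 (0, v), ‖f p‖ < ε := by
        refine hf.norm.continuousAt.eventually_lt continuousAt_const ?_
        rw [hf0, norm_zero]; exact hε
      exact this.mono fun _ h => h.le
    refine (key (fun p => dilGen p.1 p.2) ?_ ?_).and ((key (fun p => fderiv ℝ (dilGen p.1) p.2)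
      ?_ ?_).and (key (fun p => fderiv ℝ (fderiv ℝ (dilGen p.1)) p.2) ?_ ?_))
    · simp only [dilGen]
      fun_prop
    · simp [dilGen]
    · simp only [fderiv_dilGen]
      have := hq1.continuous
      fun_prop
    · simp [fderiv_dilGen]
    · simp only [hdd]
      have := hq2.continuous
      fun_prop
    · simp only [hdd, neg_zero]
      exact zero_smul ℝ
        (fderiv ℝ (fderiv ℝ fun v : ContactSpace n => ∑ i, v.1 i * v.2.1 i) v)
  have hmem : ∀ᶠ τ in 𝓝 (0 : ℝ), ∀ u ∈ C', (((1 - τ) • u.1, u.2) : ContactSpace n) ∈ W := by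
    refine hC'.eventually_forall_of_forall_eventually fun u hu => ?_
    refine ContinuousAt.eventually_mem (f := fun p : ℝ × ContactSpace n =>
      (((1 - p.1) • p.2.1, p.2.2) : ContactSpace n)) (by fun_prop) (hW.mem_nhds ?_)
    simpa using hCW hu
  -- The dilation by σ is the k-th power of the dilation by σ^(1/k), whose generating function tends
  -- to 0 with 1/k.
  have hroot : Tendsto (fun k : ℕ => 1 - σ ^ ((k : ℝ)⁻¹)) atTop (𝓝 0) := by
    have h1 : Tendsto (fun k : ℕ => σ ^ ((k : ℝ)⁻¹)) atTop (𝓝 (σ ^ (0 : ℝ))) :=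
      (Real.continuousAt_const_rpow hσ.ne').tendsto.comp tendsto_inv_atTop_nhds_zero_nat
    simpa using h1.const_sub 1
  obtain ⟨k, ⟨hk1, hk2⟩, hk0⟩ :=
    ((hroot.eventually (hsmall.and hmem)).and (eventually_ge_atTop 1)).exists
  set s : ℝ := σ ^ ((k : ℝ)⁻¹) with hs
  have hs0 : 0 < s := Real.rpow_pos_of_pos hσ _
  have hs1 : s ≤ 1 := Real.rpow_le_one hσ.le hσ1.le (by positivity)
  have hsk : s ^ k = σ := Real.rpow_inv_natCast_pow hσ.le (by omega)
  have hdg : ContDiff ℝ ∞ (dilGen (n := n) (1 - s)) :=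
    (contDiff_const.mul hq).add (contDiff_const.mul (dz (n := n)).contDiff)
  obtain ⟨F, hF, hFout, hFgen⟩ := hgen (dilGen (1 - s)) univ isOpen_univ (subset_univ _)
    hdg.contDiffOn hk1
  have hFC : ∀ u ∈ C', F u = dil s u := by
    intro u hu
    have := hFgen (s • u.1, u.2) (hχW _ (by simpa using hk2 u hu))
    rwa [genSource_dilGen hs0.ne', genTarget_dilGen] at this
  refine ⟨F^[k], isContactoOn_iterate hF k, ⟨tsupport χ, hχc, hχV, fun u hu => ?_⟩, fun u hu => ?_⟩
  · exact Function.iterate_fixed (hFout u hu) k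
  · rw [← hsk]
    have : ∀ m : ℕ, F^[m] u = dil (s ^ m) u ∧ F^[m] u ∈ C' := by
      intro m
      induction m with
      | zero => simpa using hCC' hu
      | succ m ih =>
        rw [Function.iterate_succ_apply', hFC _ ih.2]
        exact ⟨by rw [ih.1, dil_dil, pow_succ'], hC'star s ⟨hs0.le, hs1⟩ _ ih.2⟩
    exact (this k).1

/-! ### Rescaling of flat generating functions -/

/-- The linear map `(x, y, z) ↦ (x, y, t z)`. -/
def zdil (t : ℝ) : ContactSpace n →L[ℝ] ContactSpace n :=
  ContinuousLinearMap.id ℝ _ + (t - 1) • dz.smulRight reeb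

/-- Each of the two arguments of the second derivative of t⁻² S ∘ `dil t` gives up a factor t,
cancelling t⁻². What remains is `zdil t`, which at t = 0 is the projection onto the plane z = 0. -/
theorem smul_zdil (t : ℝ) : t • zdil t = (dil t : ContactSpace n →L[ℝ] ContactSpace n) := by
  refine ContinuousLinearMap.ext fun u => ?_
  refine Prod.ext ?_ (Prod.ext ?_ ?_)
  · simp [zdil, dil_apply, reeb]
  · simp [zdil, dil_apply, reeb]
  · simp [zdil, dil_apply, reeb, dz]
    ring

/-- A function whose `2`-jet at the origin vanishes except for the second derivatives involving
`z` becomes `C²`-small after rescaling by contact dilations. -/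
theorem exists_dil_small {S : ContactSpace n → ℝ} {O : Set (ContactSpace n)} (hO : IsOpen O)
    (h0 : 0 ∈ O) (hS : ContDiffOn ℝ ∞ S O) (hS0 : S 0 = 0) (hS1 : fderiv ℝ S 0 = 0)
    (hS2 : ∀ h h' : ContactSpace n, h.2.2 = 0 → h'.2.2 = 0 →
      fderiv ℝ (fderiv ℝ S) 0 h h' = 0) {ε : ℝ} (hε : 0 < ε) :
    ∃ t : ℝ, 0 < t ∧ (∀ v ∈ Metric.closedBall (0 : ContactSpace n) 1, dil t v ∈ O) ∧
      ∀ v ∈ Metric.closedBall (0 : ContactSpace n) 1,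
        ‖(t ^ 2)⁻¹ * S (dil t v)‖ ≤ ε ∧
        ‖fderiv ℝ (fun u => (t ^ 2)⁻¹ * S (dil t u)) v‖ ≤ ε ∧
        ‖fderiv ℝ (fderiv ℝ fun u => (t ^ 2)⁻¹ * S (dil t u)) v‖ ≤ ε := by
  have hSat : ∀ v ∈ O, ContDiffAt ℝ ∞ S v := fun v hv => hS.contDiffAt (hO.mem_nhds hv)
  have hSat1 : ∀ v ∈ O, ContDiffAt ℝ ∞ (fderiv ℝ S) v := fun v hv =>
    (hSat v hv).fderiv_right (by simp)
  have hSat2 : ∀ v ∈ O, ContDiffAt ℝ ∞ (fderiv ℝ (fderiv ℝ S)) v := fun v hv =>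
    (hSat1 v hv).fderiv_right (by simp)
  let pre : (ContactSpace n →L[ℝ] ContactSpace n) →
      (ContactSpace n →L[ℝ] ℝ) →L[ℝ] (ContactSpace n →L[ℝ] ℝ) :=
    fun M => (ContinuousLinearMap.compL ℝ (ContactSpace n) (ContactSpace n) ℝ).flip M
  -- For t > 0 this is the second derivative of the rescaled function; the formula extends
  -- continuously to t = 0, where only the second derivatives along z = 0 survive.
  let Q : ℝ × ContactSpace n → ContactSpace n →L[ℝ] ContactSpace n →L[ℝ] ℝ := fun p =>
    (pre (zdil p.1)).comp ((fderiv ℝ (fderiv ℝ S) (dil p.1 p.2)).comp (zdil p.1))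
  have hQapply : ∀ p w w', Q p w w' =
      fderiv ℝ (fderiv ℝ S) (dil p.1 p.2) (zdil p.1 w) (zdil p.1 w') := fun p w w' => rfl
  have hdil0 : ∀ v : ContactSpace n, dil 0 v = 0 := fun v => by simp [dil_apply]
  have hQ0 : ∀ v, Q (0, v) = 0 := by
    intro v
    refine ContinuousLinearMap.ext fun w => ContinuousLinearMap.ext fun w' => ?_
    rw [hQapply, hdil0]
    exact hS2 _ _ (by simp [zdil, reeb, dz]) (by simp [zdil, reeb, dz])
  have hzc : Continuous fun p : ℝ × ContactSpace n =>
      (zdil p.1 : ContactSpace n →L[ℝ] ContactSpace n) := by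
    simp only [zdil]
    fun_prop
  have hQc : ∀ v, ContinuousAt Q (0, v) := by
    intro v
    have h1 : ContinuousAt (fun p : ℝ × ContactSpace n => fderiv ℝ (fderiv ℝ S) (dil p.1 p.2))
        (0, v) := by
      refine ContinuousAt.comp (g := fderiv ℝ (fderiv ℝ S)) ?_ continuous_dil.continuousAt
      rw [hdil0]
      exact (hSat2 0 h0).continuousAt
    have h2 : Continuous fun p : ℝ × ContactSpace n =>
        pre (zdil p.1 : ContactSpace n →L[ℝ] ContactSpace n) :=
      ((ContinuousLinearMap.compL ℝ (ContactSpace n) (ContactSpace n) ℝ).flip.continuous).comp hzc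
    exact h2.continuousAt.clm_comp (h1.clm_comp hzc.continuousAt)
  have hev : ∀ᶠ t in 𝓝 (0 : ℝ), ∀ v ∈ Metric.closedBall (0 : ContactSpace n) 1,
      dil t v ∈ O ∧ ‖Q (t, v)‖ < ε := by
    refine (isCompact_closedBall _ _).eventually_forall_of_forall_eventually fun v _ => ?_
    refine Filter.Eventually.and ?_ ?_
    · refine continuous_dil.continuousAt.eventually_mem (hO.mem_nhds ?_)
      rw [hdil0]; exact h0
    · refine (ContinuousAt.norm (E := ContactSpace n →L[ℝ] ContactSpace n →L[ℝ] ℝ)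
        (hQc v)).eventually_lt continuousAt_const ?_
      rw [hQ0]
      exact (norm_zero (E := ContactSpace n →L[ℝ] ContactSpace n →L[ℝ] ℝ)).trans_lt hε
  obtain ⟨t, ht, ht0⟩ := ((hev.filter_mono nhdsWithin_le_nhds).and
    (self_mem_nhdsWithin (a := (0 : ℝ)) (s := Ioi 0))).exists
  have ht0 : 0 < t := ht0
  refine ⟨t, ht0, fun v hv => (ht v hv).1, ?_⟩
  set St : ContactSpace n → ℝ := fun u => (t ^ 2)⁻¹ * S (dil t u) with hSt
  have hd1 : ∀ u, dil t u ∈ O →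
      HasFDerivAt St ((t ^ 2)⁻¹ • pre (dil t) (fderiv ℝ S (dil t u))) u := by
    intro u hu
    exact (((hSat _ hu).differentiableAt (by simp)).hasFDerivAt.comp u
      (dil t).hasFDerivAt).const_mul _
  have hd2 : ∀ u, dil t u ∈ O → HasFDerivAt (fderiv ℝ St) (Q (t, u)) u := by
    intro u hu
    have h1 : fderiv ℝ St =ᶠ[𝓝 u] fun u => (t ^ 2)⁻¹ • pre (dil t) (fderiv ℝ S (dil t u)) := by
      filter_upwards [(dil t).continuous.continuousAt.eventually_mem (hO.mem_nhds hu)] with x hx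
        using (hd1 x hx).fderiv
    refine HasFDerivAt.congr_of_eventuallyEq ?_ h1
    have h2 := (((pre (dil t)).hasFDerivAt).comp u
      (((hSat1 _ hu).differentiableAt (by simp)).hasFDerivAt.comp u
        (dil t).hasFDerivAt)).const_smul ((t ^ 2)⁻¹)
    refine h2.congr_fderiv ?_
    refine ContinuousLinearMap.ext fun w => ContinuousLinearMap.ext fun w' => ?_
    rw [hQapply]
    change (t ^ 2)⁻¹ * fderiv ℝ (fderiv ℝ S) (dil t u) (dil t w) (dil t w') = _
    rw [← smul_zdil t]
    simp only [smul_apply, map_smul, smul_eq_mul]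
    field_simp
  have hball : ∀ v ∈ Metric.closedBall (0 : ContactSpace n) 1, ‖v‖ ≤ 1 := fun v hv => by simpa using hv
  have hzero : (0 : ContactSpace n) ∈ Metric.closedBall (0 : ContactSpace n) 1 := by simp
  have b2 : ∀ v ∈ Metric.closedBall (0 : ContactSpace n) 1, ‖fderiv ℝ (fderiv ℝ St) v‖ ≤ ε :=
    fun v hv => by rw [(hd2 v (ht v hv).1).fderiv]; exact (ht v hv).2.le
  -- The first derivative and then the value are bounded by integrating from the origin, where both
  -- vanish.
  have b1 : ∀ v ∈ Metric.closedBall (0 : ContactSpace n) 1, ‖fderiv ℝ St v‖ ≤ ε := by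
    intro v hv
    have h := (convex_closedBall (0 : ContactSpace n) 1).norm_image_sub_le_of_norm_fderiv_le
      (𝕜 := ℝ) (fun x hx => (hd2 x (ht x hx).1).differentiableAt) b2 hzero hv
    have h0 : fderiv ℝ St 0 = 0 := by
      rw [(hd1 0 (ht 0 hzero).1).fderiv, map_zero, hS1, map_zero, smul_zero]
    rw [h0, sub_zero, sub_zero] at h
    exact h.trans (mul_le_of_le_one_right hε.le (hball v hv))
  intro v hv
  refine ⟨?_, b1 v hv, b2 v hv⟩
  have h := (convex_closedBall (0 : ContactSpace n) 1).norm_image_sub_le_of_norm_fderiv_le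
      (𝕜 := ℝ) (fun x hx => (hd1 x (ht x hx).1).differentiableAt) b1 hzero hv
  have h0 : St 0 = 0 := by simp [hSt, hS0]
  rw [h0, sub_zero, sub_zero] at h
  exact h.trans (mul_le_of_le_one_right hε.le (hball v hv))

/-- Replacing S by t⁻² S ∘ `dil t` conjugates the generated map by the dilation; this is the source
half of that statement. -/
theorem dil_genSource {t : ℝ} (ht : t ≠ 0) (v : ContactSpace n) (l : ContactSpace n →L[ℝ] ℝ) :
    dil t (genSource v ((t ^ 2)⁻¹ • l.comp (dil t))) = genSource (dil t v) l := by
  have h1 : ∀ i : Fin n, dil t (ey i) = t • ey i := fun i => by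
    simp [dil_apply, ey]
  have h2 : dil t (reeb : ContactSpace n) = t ^ 2 • reeb := by simp [dil_apply, reeb]
  refine Prod.ext ?_ rfl
  ext i
  simp only [genSource, dil_apply, Pi.smul_apply, Pi.add_apply, smul_eq_mul, smul_apply,
    ContinuousLinearMap.comp_apply]
  rw [← dil_apply, ← dil_apply, h1, h2]
  simp only [map_smul, smul_eq_mul]
  field_simp

theorem dil_genTarget {t : ℝ} (ht : t ≠ 0) (v : ContactSpace n) (s : ℝ)
    (l : ContactSpace n →L[ℝ] ℝ) :
    dil t (genTarget v ((t ^ 2)⁻¹ * s) ((t ^ 2)⁻¹ • l.comp (dil t))) =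
      genTarget (dil t v) s l := by
  have h1 : ∀ i : Fin n, l (t • (ex i).1, t • (ex i).2.1, t ^ 2 * (ex i).2.2) = t * l (ex i) :=
    fun i => by rw [← smul_eq_mul t, ← map_smul]; simp [ex]
  refine Prod.ext rfl (Prod.ext ?_ ?_)
  · ext i
    simp only [genTarget, dil_apply t v, dil_apply t (_, _), Pi.smul_apply, Pi.add_apply,
      smul_eq_mul, smul_apply, ContinuousLinearMap.comp_apply, h1]
    field_simp
  · simp only [genTarget, dil_apply t v, dil_apply t (_, _), Pi.smul_apply,
      smul_eq_mul, smul_apply, ContinuousLinearMap.comp_apply, h1, mul_sub, mul_add, Finset.mul_sum]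
    congr 1
    · field_simp
    · refine Finset.sum_congr rfl fun i _ => ?_
      field_simp

/-- The germ at the origin of a contact transformation with a generating function which is
sufficiently flat extends to a global contactomorphism. -/
theorem exists_isContactoOn_of_germ_generating {S : ContactSpace n → ℝ} {O : Set (ContactSpace n)}
    (hO : IsOpen O) (h0 : 0 ∈ O) (hS : ContDiffOn ℝ ∞ S O) (hS0 : S 0 = 0)
    (hS1 : fderiv ℝ S 0 = 0)
    (hS2 : ∀ h h' : ContactSpace n, h.2.2 = 0 → h'.2.2 = 0 → fderiv ℝ (fderiv ℝ S) 0 h h' = 0) :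
    ∃ g, IsContactoOn g univ univ ∧
      ∀ᶠ v in 𝓝 0, g (genSource v (fderiv ℝ S v)) = genTarget v (S v) (fderiv ℝ S v) := by
  obtain ⟨χ, hχ, hχc, hχV, W, hW, hCW, hχW⟩ := exists_contDiff_cutoff
    (isCompact_singleton (x := (0 : ContactSpace n))) (Metric.isOpen_ball (x := 0) (ε := 1)) (by simp)
  obtain ⟨ε, hε, hgen⟩ := exists_isContactoOn_of_cutoff hχ hχc
  obtain ⟨t, ht, htO, hsmall⟩ := exists_dil_small hO h0 hS hS0 hS1 hS2 hε
  have hsub := hχV.trans Metric.ball_subset_closedBall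
  obtain ⟨F, hF, -, hFgen⟩ := hgen (fun u => (t ^ 2)⁻¹ * S (dil t u)) (dil t ⁻¹' O)
    (hO.preimage (dil t).continuous) (fun v hv => htO v (hsub hv))
    (contDiffOn_const.mul (hS.comp (dil t).contDiff.contDiffOn fun v hv => hv))
    (fun v hv => hsmall v (hsub hv))
  refine ⟨dil t ∘ F ∘ dil t⁻¹, (isContactoOn_dil ht.ne').comp (hF.comp
    (isContactoOn_dil (inv_ne_zero ht.ne'))), ?_⟩
  have h1 : ∀ᶠ v in 𝓝 (0 : ContactSpace n), dil t⁻¹ v ∈ W :=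
    (dil t⁻¹).continuous.continuousAt.eventually_mem (hW.mem_nhds (by simpa using hCW))
  filter_upwards [h1, hO.mem_nhds h0] with v hv hvO
  obtain ⟨u, rfl⟩ : ∃ u, v = dil t u := ⟨dil t⁻¹ v, by simp [dil_dil, ht.ne']⟩
  have hcancel : ∀ u : ContactSpace n, dil t⁻¹ (dil t u) = u := fun u => by simp [dil_dil, ht.ne']
  rw [hcancel] at hv
  have h2 := hFgen u (hχW u hv)
  have h3 : fderiv ℝ (fun u => (t ^ 2)⁻¹ * S (dil t u)) u =
      (t ^ 2)⁻¹ • (fderiv ℝ S (dil t u)).comp (dil t) :=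
    ((((hS.contDiffAt (hO.mem_nhds hvO)).differentiableAt (by simp)).hasFDerivAt.comp u
      (dil t).hasFDerivAt).const_mul _).fderiv
  rw [h3] at h2
  simp only [Function.comp_apply]
  rw [← dil_genSource ht.ne', hcancel, h2, dil_genTarget ht.ne']

/-! ### Germs tangent to the identity along the contact plane -/

/-- The bilinear form `∑ᵢ dxᵢ ⊗ dyᵢ`. -/
def pairing : ContactSpace n →L[ℝ] ContactSpace n →L[ℝ] ℝ := ∑ i, (dx i).smulRight (dy i)

theorem pairing_apply (u w : ContactSpace n) : pairing u w = ∑ i, u.1 i * w.2.1 i := by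
  simp [pairing, dx, dy]

theorem alphaSt_eq (u : ContactSpace n) : alphaSt u = dz + pairing u := by
  simp [alphaSt, pairing, dx]

@[simp] theorem dz_apply (w : ContactSpace n) : dz w = w.2.2 := rfl

theorem contDiff_alphaSt : ContDiff ℝ ∞ (alphaSt : ContactSpace n → _) := by
  rw [show (alphaSt : ContactSpace n → _) = fun u => dz + pairing u from funext alphaSt_eq]
  fun_prop

/-- Testing on `reeb` turns the pointwise conformal factor into an explicit expression, which can
then be differentiated in u. -/
theorem IsContactAt.alphaSt_fderiv {f : ContactSpace n → ContactSpace n} {u : ContactSpace n}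
    (h : IsContactAt f u) : alphaSt (f u) (fderiv ℝ f u reeb) ≠ 0 ∧ ∀ w,
      alphaSt (f u) (fderiv ℝ f u w) = alphaSt (f u) (fderiv ℝ f u reeb) * alphaSt u w := by
  obtain ⟨c, hc, h⟩ := h.exists_factor
  have : alphaSt (f u) (fderiv ℝ f u reeb) = c := by rw [h, alphaSt_reeb, mul_one]
  rw [this]
  exact ⟨hc, h⟩

/-- The germ at the origin of a contact transformation which is tangent to the identity along the
contact plane extends to a global contactomorphism. -/
theorem exists_isContactoOn_eventuallyEq_of_tangent {ψ : ContactSpace n → ContactSpace n}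
    {O : Set (ContactSpace n)} (hO : IsOpen O) (h0O : 0 ∈ O) (hψ : ∀ u ∈ O, IsContactAt ψ u)
    (hψ0 : ψ 0 = 0) (hH : ∀ w : ContactSpace n, w.2.2 = 0 → fderiv ℝ ψ 0 w = w)
    (hR : (fderiv ℝ ψ 0 reeb).2.2 = 1) :
    ∃ g, IsContactoOn g univ univ ∧ g =ᶠ[𝓝 0] ψ := by
  -- Mixed coordinates (X, y, z), in which a generating function lives. Tangency to the identity on
  -- z = 0 makes A a local diffeomorphism at 0.
  set A : ContactSpace n → ContactSpace n := fun u => ((ψ u).1, u.2) with hA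
  have hAs : ∀ u ∈ O, ContDiffAt ℝ ∞ A u := fun u hu =>
    (hψ u hu).contDiffAt.fst.prodMk contDiffAt_snd
  have hAd : ∀ u ∈ O, HasFDerivAt A (((ContinuousLinearMap.fst ℝ _ _).comp (fderiv ℝ ψ u)).prod
      (ContinuousLinearMap.snd ℝ _ _)) u := fun u hu =>
    ((hψ u hu).differentiableAt.hasFDerivAt.fst).prodMk hasFDerivAt_snd
  have hA0 : A 0 = 0 := by simp [hA, hψ0]
  have hAH : ∀ w : ContactSpace n, w.2.2 = 0 → fderiv ℝ A 0 w = w := by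
    intro w hw
    rw [(hAd 0 h0O).fderiv]
    refine Prod.ext ?_ rfl
    change (fderiv ℝ ψ 0 w).1 = w.1
    rw [hH w hw]
  have hAinv : (fderiv ℝ A 0).IsInvertible := by
    apply ContinuousLinearMap.isInvertible_of_injective
    rw [injective_iff_map_eq_zero]
    intro w hw
    have h2 : w.2 = 0 := by
      have := congrArg Prod.snd hw
      rwa [(hAd 0 h0O).fderiv] at this
    rw [← hAH w (by rw [h2]; rfl), hw]
  -- a neighbourhood on which `A` is a diffeomorphism
  have hAcd : ContinuousAt (fderiv ℝ A) 0 :=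
    ((hAs 0 h0O).fderiv_right (m := ∞) (by simp)).continuousAt
  obtain ⟨D, hD⟩ := hAinv
  have hnear : ∀ᶠ u in 𝓝 0, (fderiv ℝ A u).IsInvertible :=
    hAcd.eventually_mem (show {L : ContactSpace n →L[ℝ] ContactSpace n | L.IsInvertible} ∈ _ by
      rw [← hD]; exact ContinuousLinearEquiv.nhds D)
  have hstrict : HasStrictFDerivAt A (D : ContactSpace n →L[ℝ] ContactSpace n) 0 :=
    hD ▸ (hAs 0 h0O).hasStrictFDerivAt (by simp)
  let φ₀ := hstrict.toOpenPartialHomeomorph A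
  obtain ⟨O₁, hO₁sub, hO₁, h0O₁⟩ := eventually_nhds_iff.1 ((hO.eventually_mem h0O).and
    (hnear.and (φ₀.open_source.eventually_mem hstrict.mem_toOpenPartialHomeomorph_source)))
  have hsubO : O₁ ⊆ O := fun u hu => (hO₁sub _ hu).1
  obtain ⟨φ, hφs, hφt, hφ, hφsymm⟩ := exists_openPartialHomeomorph_of_isInvertible_fderiv
    (f := A) hO₁
    (φ₀.injOn.mono fun u hu => (hO₁sub _ hu).2.2) (fun u hu => hAs u (hsubO hu))
    (fun u hu => (hO₁sub _ hu).2.1)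
  -- the generating function
  set c : ContactSpace n → ℝ := fun u => alphaSt (ψ u) (fderiv ℝ ψ u reeb) with hc
  have hcs : ∀ u ∈ O, ContDiffAt ℝ ∞ c u := fun u hu =>
    (contDiff_alphaSt.contDiffAt.comp u (hψ u hu).contDiffAt).clm_apply
      (((hψ u hu).contDiffAt.fderiv_right (by simp)).clm_apply contDiffAt_const)
  -- The expected differential of S at A u, namely ∑ (Y − y) dX + ∑ (c x − X) dy + (c − 1) dz.
  let θ : ContactSpace n → ContactSpace n →L[ℝ] ℝ := fun u =>
    ∑ i, ((ψ u).2.1 i - u.2.1 i) • dx i + ∑ i, (c u * u.1 i - (ψ u).1 i) • dy i + (c u - 1) • dz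
  have hθapply : ∀ u w, θ u w = ∑ i, ((ψ u).2.1 i - u.2.1 i) * w.1 i +
      ∑ i, (c u * u.1 i - (ψ u).1 i) * w.2.1 i + (c u - 1) * w.2.2 := by
    intro u w
    simp [θ, dx, dy]
  let s : ContactSpace n → ℝ := fun u =>
    (ψ u).2.2 - u.2.2 + ∑ i, (ψ u).1 i * ((ψ u).2.1 i - u.2.1 i)
  have hψd : ∀ u ∈ O, DifferentiableAt ℝ ψ u := fun u hu => (hψ u hu).differentiableAt
  have hψ1 : ∀ u ∈ O, ∀ i, DifferentiableAt ℝ (fun u => (ψ u).1 i) u := fun u hu i =>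
    (dx i).differentiableAt.comp u (hψd u hu)
  have hψ2 : ∀ u ∈ O, ∀ i, DifferentiableAt ℝ (fun u => (ψ u).2.1 i) u := fun u hu i =>
    (dy i).differentiableAt.comp u (hψd u hu)
  have hψ3 : ∀ u ∈ O, DifferentiableAt ℝ (fun u => (ψ u).2.2) u := fun u hu =>
    dz.differentiableAt.comp u (hψd u hu)
  have hψc1 : ∀ u ∈ O, ∀ i, ContDiffAt ℝ ∞ (fun u => (ψ u).1 i) u := fun u hu i =>
    (dx i).contDiff.contDiffAt.comp u (hψ u hu).contDiffAt
  have hψc2 : ∀ u ∈ O, ∀ i, ContDiffAt ℝ ∞ (fun u => (ψ u).2.1 i) u := fun u hu i =>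
    (dy i).contDiff.contDiffAt.comp u (hψ u hu).contDiffAt
  have hψc3 : ∀ u ∈ O, ContDiffAt ℝ ∞ (fun u => (ψ u).2.2) u := fun u hu =>
    dz.contDiff.contDiffAt.comp u (hψ u hu).contDiffAt
  have hss : ∀ u ∈ O, ContDiffAt ℝ ∞ s u := fun u hu =>
    ((hψc3 u hu).sub (by fun_prop)).add (ContDiffAt.sum fun i _ =>
      (hψc1 u hu i).mul ((hψc2 u hu i).sub (by fun_prop)))
  -- Differentiating s = Z − z + ∑ X (Y − y) and substituting dZ + ∑ X dY = c (dz + ∑ x dy) gives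
  -- exactly θ.
  have hds : ∀ u ∈ O, ∀ w, fderiv ℝ s u w = θ u (fderiv ℝ A u w) := by
    intro u hu w
    have e1 : ∀ i, DifferentiableAt ℝ (fun u => (ψ u).2.1 i - u.2.1 i) u := fun i =>
      (hψ2 u hu i).sub (by fun_prop)
    have e2 : ∀ i, DifferentiableAt ℝ (fun u => (ψ u).1 i * ((ψ u).2.1 i - u.2.1 i)) u := fun i =>
      (hψ1 u hu i).mul (e1 i)
    have e3 : DifferentiableAt ℝ (fun u => (ψ u).2.2 - u.2.2) u := (hψ3 u hu).sub (by fun_prop)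
    have hconf := (hψ u hu).alphaSt_fderiv.2 w
    rw [alphaSt_apply, alphaSt_apply u] at hconf
    change _ = c u * _ at hconf
    rw [hθapply, (hAd u hu).fderiv]
    simp only [s]
    rw [fderiv_fun_add e3 (DifferentiableAt.fun_sum fun i _ => e2 i),
      fderiv_fun_sub (hψ3 u hu) (by fun_prop), fderiv_fun_sum fun i _ => e2 i]
    simp only [add_apply, sub_apply, sum_apply, fderiv_snd_snd]
    have e4 : ∀ i, fderiv ℝ (fun u => (ψ u).1 i * ((ψ u).2.1 i - u.2.1 i)) u w =
        (ψ u).1 i * (fderiv ℝ ψ u w).2.1 i - (ψ u).1 i * w.2.1 i +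
          ((ψ u).2.1 i - u.2.1 i) * (fderiv ℝ ψ u w).1 i := by
      intro i
      rw [fderiv_fun_mul (hψ1 u hu i) (e1 i), fderiv_fun_sub (hψ2 u hu i) (by fun_prop),
        fderiv_apply_fst (hψd u hu), fderiv_apply_snd_fst (hψd u hu)]
      simp
      ring
    simp only [e4, Finset.sum_add_distrib, Finset.sum_sub_distrib]
    rw [← fderiv_apply_snd_snd (hψd u hu)]
    simp only [ContinuousLinearMap.prod_apply, ContinuousLinearMap.comp_apply,
      ContinuousLinearMap.coe_fst', ContinuousLinearMap.coe_snd', sub_mul, Finset.sum_sub_distrib]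
    have e5 : ∑ i, c u * u.1 i * w.2.1 i = c u * ∑ i, u.1 i * w.2.1 i := by
      rw [Finset.mul_sum]
      exact Finset.sum_congr rfl fun i _ => by ring
    rw [e5]
    linarith
  set S : ContactSpace n → ℝ := fun v => s (φ.symm v) with hS
  have hVo : IsOpen (A '' O₁) := hφt ▸ φ.open_target
  have hleft : ∀ u ∈ O₁, φ.symm (A u) = u := fun u hu => by
    rw [← hφ]; exact φ.left_inv (hφs ▸ hu)
  have hSA : ∀ u ∈ O₁, S (A u) = s u := fun u hu => by simp only [hS, hleft u hu]
  have hSs : ContDiffOn ℝ ∞ S (A '' O₁) := by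
    rintro _ ⟨u, hu, rfl⟩
    refine (ContDiffAt.comp (A u) (g := s) ?_ (hφsymm _ ⟨u, hu, rfl⟩)).contDiffWithinAt
    rw [hleft u hu]
    exact hss u (hsubO hu)
  have hSd : ∀ u ∈ O₁, fderiv ℝ S (A u) = θ u := by
    intro u hu
    have h1 : S ∘ A =ᶠ[𝓝 u] s := by
      filter_upwards [hO₁.mem_nhds hu] with x hx using hSA x hx
    have h2 := h1.fderiv_eq (𝕜 := ℝ)
    rw [fderiv_comp u ((hSs.contDiffAt (hVo.mem_nhds ⟨u, hu, rfl⟩)).differentiableAt (by simp))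
      ((hAs u (hsubO hu)).differentiableAt (by simp))] at h2
    refine ContinuousLinearMap.ext fun w => ?_
    obtain ⟨w, rfl⟩ := (hO₁sub _ hu).2.1.surjective w
    rw [← hds u (hsubO hu), ← h2]
    rfl
  have hc0 : c 0 = 1 := by
    simp only [hc, hψ0, alphaSt_apply]
    simpa using hR
  have h0V : (0 : ContactSpace n) ∈ A '' O₁ := ⟨0, h0O₁, hA0⟩
  have hS0 : S 0 = 0 := by
    have := hSA 0 h0O₁
    rw [hA0] at this
    rw [this]
    simp [s, hψ0]
  have hS1 : fderiv ℝ S 0 = 0 := by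
    have := hSd 0 h0O₁
    rw [hA0] at this
    rw [this]
    simp [θ, hψ0, hc0]
  -- Along z = 0 the coefficients Y − y and c x − X have zero derivative at 0, since ψ is tangent to
  -- the identity there and c(0) = 1. The coefficient c − 1 of dz is not controlled, hence the
  -- restriction to z = 0.
  have hS2 : ∀ h h' : ContactSpace n, h.2.2 = 0 → h'.2.2 = 0 →
      fderiv ℝ (fderiv ℝ S) 0 h h' = 0 := by
    intro h h' hh hh'
    have hS' : DifferentiableAt ℝ (fderiv ℝ S) 0 :=
      ((hSs.contDiffAt (hVo.mem_nhds h0V)).fderiv_right (m := ∞) (by simp)).differentiableAt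
        (by simp)
    have hA' : DifferentiableAt ℝ A 0 := (hAs 0 h0O).differentiableAt (by simp)
    have h1 : HasFDerivAt (fun u => fderiv ℝ S (A u) h')
        (((ContinuousLinearMap.apply ℝ ℝ h').comp (fderiv ℝ (fderiv ℝ S) 0)).comp (fderiv ℝ A 0))
        0 := by
      refine HasFDerivAt.comp (g := fun v => fderiv ℝ S v h') 0 ?_ hA'.hasFDerivAt
      rw [hA0]
      exact (ContinuousLinearMap.apply ℝ ℝ h').hasFDerivAt.comp 0 hS'.hasFDerivAt
    have h2 : (fun u => fderiv ℝ S (A u) h') =ᶠ[𝓝 0] fun u =>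
        ∑ i, ((ψ u).2.1 i - u.2.1 i) * h'.1 i + ∑ i, (c u * u.1 i - (ψ u).1 i) * h'.2.1 i := by
      filter_upwards [hO₁.mem_nhds h0O₁] with u hu
      rw [hSd u hu, hθapply, hh', mul_zero, add_zero]
    have h3 := h1.fderiv
    rw [h2.fderiv_eq] at h3
    have h4 := congrArg (fun L => L h) h3
    simp only [ContinuousLinearMap.comp_apply, hAH h hh, ContinuousLinearMap.apply_apply] at h4
    rw [← h4]
    have hcd : DifferentiableAt ℝ c 0 := (hcs 0 h0O).differentiableAt (by simp)
    have e1 : ∀ i, DifferentiableAt ℝ (fun u => (ψ u).2.1 i - u.2.1 i) 0 := fun i =>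
      (hψ2 0 h0O i).sub (by fun_prop)
    have e2 : ∀ i, DifferentiableAt ℝ (fun u : ContactSpace n => c u * u.1 i) 0 := fun i =>
      hcd.mul (by fun_prop)
    have e3 : ∀ i, DifferentiableAt ℝ (fun u : ContactSpace n => c u * u.1 i - (ψ u).1 i) 0 :=
      fun i => (e2 i).sub (hψ1 0 h0O i)
    rw [fderiv_fun_add (DifferentiableAt.fun_sum fun i _ => (e1 i).mul_const _)
      (DifferentiableAt.fun_sum fun i _ => (e3 i).mul_const _),
      fderiv_fun_sum fun i _ => (e1 i).mul_const _, fderiv_fun_sum fun i _ => (e3 i).mul_const _]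
    simp only [add_apply, sum_apply]
    have f1 : ∀ i, fderiv ℝ (fun u => ((ψ u).2.1 i - u.2.1 i) * h'.1 i) 0 h = 0 := by
      intro i
      rw [fderiv_mul_const (e1 i), fderiv_fun_sub (hψ2 0 h0O i) (by fun_prop)]
      simp [← fderiv_apply_snd_fst (hψd 0 h0O), hH h hh]
    have f2 : ∀ i, fderiv ℝ (fun u : ContactSpace n => (c u * u.1 i - (ψ u).1 i) * h'.2.1 i) 0 h
        = 0 := by
      intro i
      rw [fderiv_mul_const (e3 i), fderiv_fun_sub (e2 i) (hψ1 0 h0O i),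
        fderiv_fun_mul hcd (by fun_prop)]
      simp [← fderiv_apply_fst (hψd 0 h0O), hH h hh, hc0]
    simp [f1, f2]
  obtain ⟨g, hg, hgS⟩ := exists_isContactoOn_of_germ_generating hVo h0V hSs hS0 hS1 hS2
  refine ⟨g, hg, ?_⟩
  have hAt : Tendsto A (𝓝 0) (𝓝 0) := by
    have := (hAs 0 h0O).continuousAt
    rwa [ContinuousAt, hA0] at this
  filter_upwards [hAt.eventually hgS, hO₁.mem_nhds h0O₁] with u hu huO
  rw [hSd u huO, hSA u huO] at hu
  have hcu : c u ≠ 0 := (hψ u (hsubO huO)).alphaSt_fderiv.1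
  have e1 : genSource (A u) (θ u) = u := by
    refine Prod.ext ?_ rfl
    ext i
    simp [genSource, hA, hθapply, reeb, ey, Pi.single_apply]
    field_simp
    ring
  have e2 : genTarget (A u) (s u) (θ u) = ψ u := by
    refine Prod.ext rfl (Prod.ext ?_ ?_)
    · ext i
      simp [genTarget, hA, hθapply, ex, Pi.single_apply]
    · simp [genTarget, hA, hθapply, ex, Pi.single_apply, s]
      ring
  rwa [e1, e2] at hu

/-! ### Normalising a germ: translations and linear parts -/

@[simp] theorem pairing_reeb (u : ContactSpace n) : pairing u reeb = 0 := by
  simp [pairing_apply, reeb]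

@[simp] theorem reeb_pairing (u : ContactSpace n) : pairing reeb u = 0 := by
  simp [pairing_apply, reeb]

@[simp] theorem reeb_snd_snd : (reeb : ContactSpace n).2.2 = 1 := rfl

/-- The contact translation sending the origin to `p`. -/
def trans (p w : ContactSpace n) : ContactSpace n := w + p - pairing p w • reeb

/-- Translating x by a adds ∑ aᵢ dyᵢ to the form; the term −∑ aᵢ yᵢ in the last coordinate cancels
it, so the form is preserved exactly. -/
theorem isContactoOn_trans (p : ContactSpace n) : IsContactoOn (trans p) univ univ := by
  refine .of_inverse (g := fun v => v - p + pairing p (v - p) • reeb) ?_ ?_ ?_ ?_ ?_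
  · unfold trans; fun_prop
  · fun_prop
  · intro w
    simp [trans]
    abel
  · intro v
    simp [trans]
    abel
  · intro u
    refine ⟨1, one_ne_zero, fun w => ?_⟩
    have h : HasFDerivAt (trans p) (.id ℝ _ - (pairing p).smulRight reeb) u :=
      ((hasFDerivAt_id u).add_const p).sub ((pairing p).hasFDerivAt.smul_const reeb)
    rw [h.fderiv, alphaSt_eq, alphaSt_eq]
    simp only [trans, add_apply, sub_apply, ContinuousLinearMap.id_apply,
      ContinuousLinearMap.smulRight_apply, map_add, map_sub, map_smul, smul_apply, dz_apply, reeb_snd_snd,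
      pairing_reeb, reeb_pairing, smul_eq_mul]
    ring

theorem trans_zero (p : ContactSpace n) : trans p 0 = p := by simp [trans]

/-- The quadratic shear `(x, y, z) ↦ (x, y, z + k ∑ᵢ xᵢ yᵢ)`. -/
def shear (k : ℝ) (w : ContactSpace n) : ContactSpace n := w + (k * pairing w w) • reeb

theorem contDiff_shear (k : ℝ) : ContDiff ℝ ∞ (shear k : ContactSpace n → ContactSpace n) := by
  unfold shear; fun_prop

theorem shear_shear_neg (k : ℝ) (w : ContactSpace n) : shear k (shear (-k) w) = w := by
  simp [shear]

theorem hasFDerivAt_shear (k : ℝ) (w : ContactSpace n) :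
    HasFDerivAt (shear k)
      (.id ℝ _ + (k • (pairing w + pairing.flip w)).smulRight reeb) w := by
  have h := (pairing (n := n)).hasFDerivAt (x := w) |>.clm_apply (hasFDerivAt_id w)
  refine ((hasFDerivAt_id w).add ((h.const_mul k).smul_const reeb)).congr_fderiv ?_
  ext v <;> simp

/-- A conformally symplectic linear map which preserves `dz` up to the same factor lifts to a
contactomorphism. -/
theorem exists_isContactoOn_of_linear (L : ContactSpace n ≃L[ℝ] ContactSpace n) {c : ℝ}
    (hc : c ≠ 0) (hdz : ∀ v, (L v).2.2 = c * v.2.2) (hreeb : L reeb = c • reeb)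
    (hω : ∀ v w, pairing (L v) (L w) - pairing (L w) (L v) = c * (pairing v w - pairing w v)) :
    ∃ T, IsContactoOn T univ univ ∧ T 0 = 0 ∧
      HasFDerivAt T (L : ContactSpace n →L[ℝ] ContactSpace n) 0 := by
  -- In the coordinate z + ½ ∑ xᵢ yᵢ the standard form becomes dz + ½ ∑ (xᵢ dyᵢ − yᵢ dxᵢ), which L
  -- multiplies by c. Conjugating by the shear transports this back.
  have hT : ∀ w, HasFDerivAt (shear (-(1 / 2)) ∘ L ∘ shear (1 / 2)) _ w := fun w =>
    (hasFDerivAt_shear (-(1 / 2)) _).comp w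
      (L.hasFDerivAt.comp w (hasFDerivAt_shear (1 / 2) w))
  refine ⟨shear (-(1 / 2)) ∘ L ∘ shear (1 / 2), .of_inverse
    (g := shear (-(1 / 2)) ∘ L.symm ∘ shear (1 / 2)) ?_ ?_ ?_ ?_ ?_, ?_, ?_⟩
  · exact (contDiff_shear _).comp (L.contDiff.comp (contDiff_shear _))
  · exact (contDiff_shear _).comp (L.symm.contDiff.comp (contDiff_shear _))
  · intro w
    simp only [Function.comp_apply, shear_shear_neg, L.symm_apply_apply]
    simpa using shear_shear_neg (-(1 / 2)) w
  · intro w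
    simp only [Function.comp_apply, shear_shear_neg, L.apply_symm_apply]
    simpa using shear_shear_neg (-(1 / 2)) w
  · intro w
    refine ⟨c, hc, fun v => ?_⟩
    rw [(hT w).fderiv, alphaSt_eq, alphaSt_eq]
    have h := hω w v
    simp [shear, hreeb, hdz] at h ⊢
    linarith
  · simp [shear]
  · refine (hT 0).congr_fderiv ?_
    refine ContinuousLinearMap.ext fun v => ?_
    simp [shear]

/-- The linearization of a contact germ fixing the origin. -/
theorem exists_linear_of_isContactAt {ψ : ContactSpace n → ContactSpace n} {O : Set (ContactSpace n)}
    (hO : IsOpen O) (h0O : 0 ∈ O) (hψ : ∀ u ∈ O, IsContactAt ψ u) (hψ0 : ψ 0 = 0) :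
    ∃ T, IsContactoOn T univ univ ∧ T 0 = 0 ∧
      (∀ w : ContactSpace n, w.2.2 = 0 → fderiv ℝ T 0 w = fderiv ℝ ψ 0 w) ∧
      (fderiv ℝ T 0 reeb).2.2 = (fderiv ℝ ψ 0 reeb).2.2 ∧
      ∀ w, (fderiv ℝ T 0 w).2.2 = (fderiv ℝ T 0 reeb).2.2 * w.2.2 := by
  set D := fderiv ℝ ψ 0 with hD
  obtain ⟨hc0, hconf⟩ := (hψ 0 h0O).alphaSt_fderiv
  set c : ContactSpace n → ℝ := fun u => alphaSt (ψ u) (fderiv ℝ ψ u reeb) with hc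
  have ha0 : alphaSt (0 : ContactSpace n) = dz := by simp [alphaSt_eq]
  change c 0 ≠ 0 at hc0
  have hcD : (D reeb).2.2 = c 0 := by simp [hc, hψ0, ha0, hD]
  have hdzD : ∀ w, (D w).2.2 = c 0 * w.2.2 := by
    intro w
    have := hconf w
    rwa [hψ0, ha0, ← hD, dz_apply, dz_apply, dz_apply, hcD] at this
  have hψs : ContDiffAt ℝ ∞ ψ 0 := (hψ 0 h0O).contDiffAt
  have hψ1 : ContDiffAt ℝ ∞ (fderiv ℝ ψ) 0 := hψs.fderiv_right (by simp)
  have hcs : ContDiffAt ℝ ∞ c 0 :=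
    (contDiff_alphaSt.contDiffAt.comp 0 hψs).clm_apply (hψ1.clm_apply contDiffAt_const)
  have hsymm : IsSymmSndFDerivAt ℝ ψ 0 := hψs.isSymmSndFDerivAt (by
    rw [minSmoothness_of_isRCLikeNormedField]; exact WithTop.coe_le_coe.2 (le_top : (2 : ℕ∞) ≤ ⊤))
  have hda : ∀ u : ContactSpace n, HasFDerivAt alphaSt (pairing : ContactSpace n →L[ℝ] _) u := by
    intro u
    rw [show (alphaSt : ContactSpace n → _) = fun u => dz + pairing u from funext alphaSt_eq]
    exact pairing.hasFDerivAt.const_add dz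
  -- Differentiating ψ^*α = c α at 0 in the direction v. The second derivative of ψ is symmetric, so
  -- antisymmetrising in v and w removes it and leaves conformal symplecticity on the contact plane.
  have hkey : ∀ v w : ContactSpace n, w.2.2 = 0 →
      pairing (D v) (D w) + dz (fderiv ℝ (fderiv ℝ ψ) 0 v w) = c 0 * pairing v w := by
    intro v w hw
    have h1 : HasFDerivAt (fun u => alphaSt (ψ u)) (pairing.comp D) 0 :=
      HasFDerivAt.comp 0 (hda (ψ 0)) (hψs.differentiableAt (by simp)).hasFDerivAt
    have h2 := (h1.clm_apply ((hψ1.differentiableAt (by simp)).hasFDerivAt.clm_apply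
      (hasFDerivAt_const w 0))).fderiv
    have h3 := ((hcs.differentiableAt (by simp)).hasFDerivAt.mul
      ((hda 0).clm_apply (hasFDerivAt_const w 0))).fderiv
    have h4 : (fun u => alphaSt (ψ u) (fderiv ℝ ψ u w)) =ᶠ[𝓝 0] c * fun u => alphaSt u w := by
      filter_upwards [hO.mem_nhds h0O] with u hu using (hψ u hu).alphaSt_fderiv.2 w
    rw [h4.fderiv_eq] at h2
    have h5 := congrArg (fun M => M v) (h2.symm.trans h3)
    simp only [hψ0, ha0, ← hD] at h5
    simp [hw] at h5
    simpa [add_comm] using h5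
  have hωH : ∀ v w : ContactSpace n, v.2.2 = 0 → w.2.2 = 0 →
      pairing (D v) (D w) - pairing (D w) (D v) = c 0 * (pairing v w - pairing w v) := by
    intro v w hv hw
    have h1 := hkey v w hw
    have h2 := hkey w v hv
    rw [hsymm.eq w v] at h2
    linarith
  -- D is kept on the contact plane, but `reeb` is sent to c(0) times itself, as the linear lift
  -- requires; the horizontal part of D `reeb` is discarded.
  let L₀ : ContactSpace n →L[ℝ] ContactSpace n := D + dz.smulRight (c 0 • reeb - D reeb)
  have hL₀ : ∀ w, L₀ w = D (w - w.2.2 • reeb) + (w.2.2 * c 0) • reeb := by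
    intro w
    simp [L₀, smul_sub, smul_smul]
    abel
  have hproj : ∀ w : ContactSpace n, (w - w.2.2 • (reeb : ContactSpace n)).2.2 = 0 := fun w => by
    simp [reeb]
  have hL₀z : ∀ w, (L₀ w).2.2 = c 0 * w.2.2 := by
    intro w
    rw [hL₀]
    simp only [Prod.snd_add, hdzD, hproj]
    simp [reeb, mul_comm]
  have hL₀inj : Function.Injective L₀ := by
    rw [injective_iff_map_eq_zero]
    intro w hw
    have h1 : w.2.2 = 0 := by
      have := hL₀z w
      rw [hw] at this
      simpa [hc0] using this.symm
    rw [hL₀, h1] at hw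
    simp only [zero_smul, sub_zero, zero_mul, add_zero] at hw
    exact (hψ 0 h0O).isInvertible.injective (hw.trans (map_zero _).symm)
  obtain ⟨L, hL⟩ := ContinuousLinearMap.isInvertible_of_injective hL₀inj
  have hLapply : ∀ w, L w = L₀ w := fun w => congrArg (fun M => M w) hL
  obtain ⟨T, hT, hT0, hTd⟩ := exists_isContactoOn_of_linear L hc0
    (fun v => by rw [hLapply]; exact hL₀z v)
    (by rw [hLapply, hL₀]; simp [reeb])
    (fun v w => by
      have h := hωH _ _ (hproj v) (hproj w)
      rw [hLapply, hLapply, hL₀, hL₀]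
      simp only [map_add, map_smul, add_apply, smul_apply, pairing_reeb, reeb_pairing,
        smul_zero, add_zero]
      rw [h]
      simp)
  have hTD : fderiv ℝ T 0 = L₀ := hTd.fderiv.trans hL
  refine ⟨T, hT, hT0, fun w hw => ?_, ?_, fun w => ?_⟩
  · rw [hTD, hL₀, hw]; simp
  · rw [hTD, hL₀z, hdzD]
  · rw [hTD, hL₀z, hL₀z]; simp [reeb]

/-- Every germ of a contact transformation at the origin extends to a global contactomorphism. -/
theorem exists_isContactoOn_eventuallyEq {ψ : ContactSpace n → ContactSpace n}
    {O : Set (ContactSpace n)} (hO : IsOpen O) (h0O : 0 ∈ O) (hψ : ∀ u ∈ O, IsContactAt ψ u) :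
    ∃ g, IsContactoOn g univ univ ∧ g =ᶠ[𝓝 0] ψ := by
  obtain ⟨e, he, hinv⟩ := (isContactoOn_trans (ψ 0)).exists_inverse
  have he0 : e (ψ 0) = 0 := by
    conv_lhs => rw [← trans_zero (ψ 0)]
    rw [trans_zero]
    have := hinv.1 (mem_univ 0)
    rwa [trans_zero] at this
  have hψ₁ : ∀ u ∈ O, IsContactAt (e ∘ ψ) u := fun u hu =>
    (he.isContactAt _ (mem_univ _)).comp (hψ u hu)
  -- T matches the derivative only on the contact plane and in the z-component of the image of
  -- `reeb`; that suffices for the tangent case.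
  obtain ⟨T, hT, hT0, hTH, hTR, hTz⟩ := exists_linear_of_isContactAt hO h0O hψ₁ he0
  obtain ⟨t, ht, htinv⟩ := hT.exists_inverse
  have ht0 : t 0 = 0 := by
    have := htinv.1 (mem_univ 0)
    rwa [hT0] at this
  have hψ₂ : ∀ u ∈ O, IsContactAt (t ∘ e ∘ ψ) u := fun u hu =>
    (ht.isContactAt _ (mem_univ _)).comp (hψ₁ u hu)
  have hψ₂0 : (t ∘ e ∘ ψ) 0 = 0 := by simp [he0, ht0]
  have hcomp : T ∘ (t ∘ e ∘ ψ) = e ∘ ψ := funext fun u => htinv.2 (mem_univ _)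
  have hchain : ∀ w, fderiv ℝ T 0 (fderiv ℝ (t ∘ e ∘ ψ) 0 w) = fderiv ℝ (e ∘ ψ) 0 w := by
    intro w
    have h := fderiv_comp (0 : ContactSpace n) (g := T)
      (hT.isContactAt _ (mem_univ _)).differentiableAt (hψ₂ 0 h0O).differentiableAt
    rw [hcomp, hψ₂0] at h
    rw [h]
    rfl
  obtain ⟨g, hg, hgψ⟩ := exists_isContactoOn_eventuallyEq_of_tangent hO h0O hψ₂ hψ₂0
    (fun w hw => (hT.isContactAt 0 (mem_univ _)).isInvertible.injective
      (by rw [hchain, hTH w hw]))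
    (by
      have h1 := hTz (fderiv ℝ (t ∘ e ∘ ψ) 0 reeb)
      rw [hchain, ← hTR] at h1
      have h2 : (fderiv ℝ T 0 reeb).2.2 ≠ 0 := by
        have := (hT.isContactAt 0 (mem_univ _)).alphaSt_fderiv.1
        rw [hT0, alphaSt_apply] at this
        simpa using this
      exact (mul_left_cancel₀ h2 (by rw [mul_one]; exact h1)).symm)
  refine ⟨trans (ψ 0) ∘ T ∘ g, (isContactoOn_trans _).comp (hT.comp hg), ?_⟩
  filter_upwards [hgψ] with u hu
  simp only [Function.comp_apply] at hu ⊢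
  rw [hu, htinv.2 (mem_univ _), hinv.2 (mem_univ _)]

/-! ### Embeddings of the whole space and increasing unions -/

/-- A contact embedding of the whole space agrees on any compact set with a contactomorphism. -/
theorem IsContactoOn.exists_eqOn {ψ : ContactSpace n → ContactSpace n} {V K : Set (ContactSpace n)}
    (hψ : IsContactoOn ψ univ V) (hK : IsCompact K) :
    ∃ f, IsContactoOn f univ univ ∧ EqOn f ψ K := by
  classical
  obtain ⟨g, hg, hgψ⟩ := exists_isContactoOn_eventuallyEq isOpen_univ (mem_univ 0) hψ.isContactAt
  have hσ : ∀ᶠ σ in 𝓝 (0 : ℝ), ∀ u ∈ K, g (dil σ u) = ψ (dil σ u) := by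
    refine hK.eventually_forall_of_forall_eventually fun u _ => ?_
    refine Tendsto.eventually (f := fun p : ℝ × ContactSpace n => dil p.1 p.2) ?_ hgψ
    have := (continuous_dil (n := n)).tendsto (0, u)
    rwa [show dil ((0 : ℝ), u).1 ((0 : ℝ), u).2 = 0 by simp [dil_apply]] at this
  obtain ⟨σ, ⟨hσ, hσ1⟩, hσ0⟩ := (((hσ.and (eventually_lt_nhds zero_lt_one)).filter_mono
    nhdsWithin_le_nhds).and (self_mem_nhdsWithin (a := (0 : ℝ)) (s := Ioi 0))).exists
  obtain ⟨c, hc, ⟨K', hK', -, hcK'⟩, hcK⟩ := exists_compactly_supported_dil isOpen_univ (mem_univ 0)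
    (fun _ _ _ _ _ => mem_univ _) hK (subset_univ _) hσ0 hσ1
  obtain ⟨e, he, hinv⟩ := hψ.exists_inverse
  have hVo := hψ.isOpen_target
  -- The cut-off dilation transported by ψ. It is the identity off the compact set ψ(K') ⊆ V, so the
  -- extension by the identity is smooth.
  let F : ContactSpace n → ContactSpace n := fun u => if u ∈ V then ψ (c (e u)) else u
  have hFV : ∀ u ∈ V, F u = (ψ ∘ c ∘ e) u := fun u hu => if_pos hu
  have hFV' : ∀ u ∉ V, F u = u := fun u hu => if_neg hu
  have hcomp : IsContactoOn (ψ ∘ c ∘ e) V V := hψ.comp (hc.comp he)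
  have hFout : ∀ u ∉ ψ '' K', F u = u := by
    intro u hu
    by_cases huV : u ∈ V
    · rw [hFV u huV]
      have : e u ∉ K' := fun h => hu ⟨e u, h, hinv.2 huV⟩
      simp only [Function.comp_apply, hcK' _ this, hinv.2 huV]
    · exact hFV' u huV
  have hFmaps : ∀ u, F u ∈ V ↔ u ∈ V := by
    intro u
    by_cases hu : u ∈ V
    · simp only [hu, iff_true, hFV u hu]
      exact hcomp.bijOn.mapsTo hu
    · rw [hFV' u hu]
  have hF : IsContactoOn F univ univ := by
    refine ⟨isOpen_univ, bijOn_univ.2 ⟨fun a b hab => ?_, fun v => ?_⟩, fun u _ => ?_⟩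
    · by_cases ha : a ∈ V
      · have hb : b ∈ V := by rwa [← hFmaps, ← hab, hFmaps]
        rw [hFV a ha, hFV b hb] at hab
        exact hcomp.bijOn.injOn ha hb hab
      · have hb : b ∉ V := by rwa [← hFmaps, ← hab, hFmaps]
        rwa [hFV' a ha, hFV' b hb] at hab
    · by_cases hv : v ∈ V
      · obtain ⟨u, hu, rfl⟩ := hcomp.bijOn.surjOn hv
        exact ⟨u, hFV u hu⟩
      · exact ⟨v, hFV' v hv⟩
    · by_cases hu : u ∈ V
      · refine (hcomp.isContactAt u hu).congr ?_
        filter_upwards [hVo.mem_nhds hu] with x hx using hFV x hx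
      · have hcl : IsClosed (ψ '' K') :=
          (hK'.image_of_continuousOn (hψ.continuousOn.mono (subset_univ _))).isClosed
        refine (isContactAt_id u).congr ?_
        have : u ∉ ψ '' K' := by
          rintro ⟨x, -, rfl⟩
          exact hu (hψ.bijOn.mapsTo (mem_univ x))
        filter_upwards [hcl.isOpen_compl.mem_nhds this] with x hx using hFout x hx
  obtain ⟨G, hG, hGinv⟩ := hF.exists_inverse
  -- On K the map c lands where g = ψ, so g c = ψ c = F ψ there, and G = F⁻¹ leaves ψ.
  refine ⟨G ∘ g ∘ c, hG.comp (hg.comp hc), fun u hu => ?_⟩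
  have h1 : ψ (c u) = F (ψ u) := by
    rw [hFV _ (hψ.bijOn.mapsTo (mem_univ u))]
    simp only [Function.comp_apply, hinv.1 (mem_univ u)]
  simp only [Function.comp_apply]
  rw [hcK u hu, hσ u hu, ← hcK u hu, h1, hGinv.1 (mem_univ _)]

/-- An increasing union of open sets contactomorphic to the standard contact space is
contactomorphic to the standard contact space. -/
theorem contactomorphic_iUnion_univ {U : ℕ → Set (ContactSpace n)} (hU : Monotone U)
    (h : ∀ i, Contactomorphic (U i) xiSt univ xiSt) :
    Contactomorphic (⋃ i, U i) xiSt univ xiSt := by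
  simp only [contactomorphic_iff] at h ⊢
  have hUo : ∀ i, IsOpen (U i) := fun i => (h i).choose_spec.isOpen
  have := exists_isContactoOn_iUnion (V := fun _ => univ) hU monotone_const hUo
    (fun _ => isOpen_univ) (h 0) fun i f K hf hK hKU => ?_
  · rwa [iUnion_const] at this
  · obtain ⟨φ, hφ⟩ := h (i + 1)
    obtain ⟨e, he, hinv⟩ := hf.exists_inverse
    -- The transition map φ ∘ f⁻¹ embeds the whole space; matching it on f(K) by a global F makes
    -- F⁻¹ ∘ φ agree with f on K.
    have hψ := (hφ.mono (hUo i) (hU i.le_succ)).comp he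
    obtain ⟨F, hF, hFψ⟩ := hψ.exists_eqOn (hK.image_of_continuousOn (hf.continuousOn.mono hKU))
    obtain ⟨G, hG, hGinv⟩ := hF.exists_inverse
    refine ⟨G ∘ φ, hG.comp hφ, fun u hu => ?_⟩
    have h1 := hFψ (mem_image_of_mem f hu)
    simp only [Function.comp_apply, hinv.1 (hKU hu)] at h1
    rw [Function.comp_apply, ← h1, hGinv.1 (mem_univ _)]

/-! ### Sets star-shaped for contact dilations -/

/-- An open set which is star-shaped for the contact dilations is contactomorphic to the whole
space. -/
theorem exists_isContactoOn_of_starShaped {V : Set (ContactSpace n)} (hV : IsOpen V) (h0 : 0 ∈ V)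
    (hstar : ∀ u ∈ V, ∀ t, 0 < t → t ≤ 1 → dil t u ∈ V) : ∃ f, IsContactoOn f V univ := by
  -- `W i` is the dilate of V by 2^i.
  let W : ℕ → Set (ContactSpace n) := fun i => dil ((1 / 2) ^ i) ⁻¹' V
  have hW : ∀ i, IsOpen (W i) := fun i => hV.preimage (dil _).continuous
  have hW0 : ∀ i, 0 ∈ W i := fun i => by simpa [W] using h0
  have hWstar : ∀ i, ∀ u ∈ W i, ∀ t, 0 < t → t ≤ 1 → dil t u ∈ W i := by
    intro i u hu t ht ht1
    simp only [W, mem_preimage, dil_dil] at hu ⊢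
    rw [mul_comm, ← dil_dil]
    exact hstar _ hu t ht ht1
  have hsucc : ∀ i u, u ∈ W (i + 1) ↔ dil (1 / 2) u ∈ W i := by
    intro i u
    simp only [W, mem_preimage, dil_dil, pow_succ]
  have hWmono : Monotone W := monotone_nat_of_le_succ fun i u hu => by
    rw [hsucc]
    exact hWstar i u hu _ (by norm_num) (by norm_num)
  have hunion : ⋃ i, W i = univ := by
    refine eq_univ_of_forall fun u => ?_
    have h1 : Tendsto (fun i : ℕ => dil ((1 / 2 : ℝ) ^ i) u) atTop (𝓝 0) := by
      have h2 : Continuous fun s : ℝ => dil s u :=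
        continuous_dil.comp (continuous_id.prodMk continuous_const)
      exact (h2.tendsto' 0 0 (by simp [dil_apply])).comp
        (tendsto_pow_atTop_nhds_zero_of_lt_one (by norm_num) (by norm_num))
    obtain ⟨i, hi⟩ := (h1.eventually_mem (hV.mem_nhds h0)).exists
    exact mem_iUnion.2 ⟨i, hi⟩
  have hW00 : W 0 = V := by
    ext u
    simp [W]
  have := exists_isContactoOn_iUnion (U := fun _ => V) (V := W) monotone_const hWmono
    (fun _ => hV) hW ⟨id, by rw [hW00]; exact .id hV⟩ fun i f K hf hK hKV => ?_
  · rwa [iUnion_const, hunion] at this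
  · obtain ⟨c, hc, ⟨L, hL, hLW, hcL⟩, hcK⟩ := exists_compactly_supported_dil (hW i) (hW0 i)
      (hWstar i) (hK.image_of_continuousOn (hf.continuousOn.mono hKV))
      (image_subset_iff.2 fun u hu => hf.bijOn.mapsTo (hKV hu))
      (show (0 : ℝ) < 1 / 2 by norm_num) (by norm_num)
    have hcmaps : ∀ u ∉ W i, c u = u := fun u hu => hcL u fun h => hu (hLW h)
    have hcW : BijOn c (W i) (W i) := by
      have hinj := hc.bijOn.injOn
      refine ⟨fun u hu => ?_, hinj.mono (subset_univ _), fun v hv => ?_⟩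
      · by_contra h
        have := hinj (mem_univ _) (mem_univ _) (hcmaps _ h)
        exact h (by rw [this]; exact hu)
      · obtain ⟨u, -, rfl⟩ := hc.bijOn.surjOn (mem_univ v)
        refine ⟨u, ?_, rfl⟩
        by_contra h
        rw [hcmaps u h] at hv
        exact h hv
    have hdil : IsContactoOn (dil 2 : ContactSpace n → ContactSpace n) (W i) (W (i + 1)) := by
      refine ⟨hW i, ⟨fun u hu => ?_, ?_, fun v hv => ?_⟩, fun u _ =>
        (isContactoOn_dil two_ne_zero).isContactAt u (mem_univ u)⟩
      · rw [hsucc, dil_dil]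
        simpa using hu
      · exact (isContactoOn_dil two_ne_zero).bijOn.injOn.mono (subset_univ _)
      · exact ⟨dil (1 / 2) v, (hsucc i v).1 hv, by simp [dil_dil]⟩
    -- c maps `W i` onto itself and halves on f(K), so the doubling that enlarges the target is
    -- undone exactly there.
    refine ⟨dil 2 ∘ c ∘ f, hdil.comp (IsContactoOn.comp ⟨hW i, hcW, fun u _ =>
      hc.isContactAt u (mem_univ u)⟩ hf), fun u hu => ?_⟩
    simp only [Function.comp_apply]
    rw [hcK _ (mem_image_of_mem f hu), dil_dil]
    simp

/-! ### The complement of the half-line and the rotational structure -/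

theorem isClosed_halfLine : IsClosed (halfLine n) :=
  (isClosed_eq continuous_fst continuous_const).inter
    ((isClosed_eq (continuous_fst.comp continuous_snd) continuous_const).inter
      (isClosed_le continuous_const (continuous_snd.comp continuous_snd)))

/-- The half-line starts at the origin, so it is first moved up by `reeb`. A dilation with t ≤ 1
multiplies heights on the axis by t², so points below height 1 stay below it, and the complement is
star-shaped. -/
theorem exists_isContactoOn_compl_halfLine : ∃ f, IsContactoOn f (halfLine n)ᶜ univ := by
  let V : Set (ContactSpace n) := {p | p + -reeb ∈ (halfLine n)ᶜ}
  have hVo : IsOpen V := isClosed_halfLine.isOpen_compl.preimage (by fun_prop)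
  have hVmem : ∀ p, p ∈ V ↔ (p.1 = 0 → p.2.1 = 0 → p.2.2 < 1) := by
    intro p
    simp [V, halfLine, reeb]
  obtain ⟨f, hf⟩ := exists_isContactoOn_of_starShaped hVo (by simp [hVmem]) (by
    intro u hu t ht ht1
    rw [hVmem] at hu ⊢
    intro h1 h2
    simp only [dil_apply, smul_eq_zero, ht.ne', false_or] at h1 h2 ⊢
    linarith [mul_lt_mul_of_pos_left (hu h1 h2) (pow_pos ht 2), pow_le_one₀ ht.le ht1 (n := 2)])
  obtain ⟨g, hg⟩ : ∃ g, IsContactoOn g (halfLine n)ᶜ V := by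
    have htr := isContactoOn_trans (reeb : ContactSpace n)
    have happ : ∀ w : ContactSpace n, trans reeb w = w + reeb := fun w => by simp [trans]
    refine ⟨trans reeb, isClosed_halfLine.isOpen_compl, ⟨fun u hu => ?_,
      htr.bijOn.injOn.mono (subset_univ _), fun v hv => ⟨v + -reeb, hv, ?_⟩⟩,
      fun u _ => htr.isContactAt u (mem_univ u)⟩
    · rw [happ]
      simpa [V] using hu
    · rw [happ]
      simp
  exact ⟨f ∘ g, hf.comp hg⟩

/-- The map `(x, y, z) ↦ (2 x, y, z - ∑ᵢ xᵢ yᵢ)` takes `ξ_rot` to `ξ_st`. -/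
def rotToSt (w : ContactSpace n) : ContactSpace n :=
  ((2 : ℝ) • w.1, w.2.1, w.2.2 - ∑ i, w.1 i * w.2.1 i)

/-- The differential of −∑ xᵢ yᵢ turns 2 xᵢ dyᵢ into xᵢ dyᵢ − yᵢ dxᵢ, so the pullback is exact, with
factor 1. -/
theorem alphaSt_fderiv_rotToSt (u w : ContactSpace n) :
    alphaSt (rotToSt u) (fderiv ℝ rotToSt u w) = alphaRot u w := by
  have hd : DifferentiableAt ℝ (rotToSt (n := n)) u := by
    unfold rotToSt
    fun_prop
  rw [alphaSt_apply, alphaRot_apply, fderiv_apply_snd_snd hd]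
  simp only [fderiv_apply_snd_fst hd]
  simp only [rotToSt, fderiv_snd_fst, Pi.smul_apply, smul_eq_mul]
  rw [fderiv_fun_sub (by fun_prop) (by fun_prop), sub_apply, fderiv_snd_snd, fderiv_sum_mul,
    sub_add, ← Finset.sum_sub_distrib, sub_eq_add_neg, ← Finset.sum_neg_distrib]
  congr 1
  exact Finset.sum_congr rfl fun i _ => by ring

theorem contactomorphic_rot_of_isContactoOn {U W : Set (ContactSpace n)}
    {f : ContactSpace n → ContactSpace n} (hU : IsOpen U) (hf : IsContactoOn f W univ)
    (hUW : BijOn rotToSt U W) : Contactomorphic U xiRot univ xiSt := by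
  let r : ContactSpace n → ContactSpace n := fun w =>
    ((1 / 2 : ℝ) • w.1, w.2.1, w.2.2 + 1 / 2 * ∑ i, w.1 i * w.2.1 i)
  have hrs : ContDiff ℝ ∞ (rotToSt (n := n)) := by unfold rotToSt; fun_prop
  have hrs' : ContDiff ℝ ∞ r := by fun_prop
  have h1 : ∀ w, r (rotToSt w) = w := by
    intro w
    refine Prod.ext ?_ (Prod.ext rfl ?_)
    · ext i; simp [r, rotToSt]
    · simp [r, rotToSt, Finset.mul_sum, ← mul_assoc]
  have h2 : ∀ w, rotToSt (r w) = w := by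
    intro w
    refine Prod.ext ?_ (Prod.ext rfl ?_)
    · ext i; simp [r, rotToSt]
    · simp [r, rotToSt, Finset.mul_sum, mul_assoc]
  have hinv : ∀ u, (fderiv ℝ (rotToSt (n := n)) u).IsInvertible := by
    intro u
    have e1 : fderiv ℝ (r ∘ rotToSt) u = .id ℝ _ := by
      rw [show r ∘ rotToSt = id from funext h1, fderiv_id]
    have e2 : fderiv ℝ (rotToSt ∘ r) (rotToSt u) = .id ℝ _ := by
      rw [show rotToSt ∘ r = id from funext h2, fderiv_id]
    have d1 : Differentiable ℝ r := hrs'.differentiable (by simp)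
    have d2 : Differentiable ℝ (rotToSt (n := n)) := hrs.differentiable (by simp)
    rw [fderiv_comp _ (d1 _) (d2 _)] at e1
    rw [fderiv_comp _ (d2 _) (d1 _), h1] at e2
    exact .of_inverse e2 e1
  have hfd : ∀ u ∈ U, IsContactAt f (rotToSt u) := fun u hu =>
    hf.isContactAt _ (hUW.mapsTo hu)
  have hchain : ∀ u ∈ U, fderiv ℝ (f ∘ rotToSt) u =
      (fderiv ℝ f (rotToSt u)).comp (fderiv ℝ rotToSt u) := fun u hu =>
    fderiv_comp u (hfd u hu).differentiableAt (hrs.differentiable (by simp) u)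
  obtain ⟨φ, hφs, hφt, hφ, hφsymm⟩ := exists_openPartialHomeomorph_of_isInvertible_fderiv hU
    (f := f ∘ rotToSt) (hf.bijOn.injOn.comp hUW.injOn hUW.mapsTo)
    (fun u hu => (hfd u hu).contDiffAt.comp u hrs.contDiffAt)
    (fun u hu => by rw [hchain u hu]; exact (hfd u hu).isInvertible.comp (hinv u))
  rw [(hf.bijOn.comp hUW).image_eq] at hφt hφsymm
  refine ⟨φ, hφs, hφt, fun u hu => ?_, fun v hv => (hφsymm v hv).contDiffWithinAt, fun u hu => ?_⟩
  · rw [hφ]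
    exact ((hfd u hu).contDiffAt.comp u hrs.contDiffAt).contDiffWithinAt
  · obtain ⟨c, hc, hcu⟩ := (hfd u hu).exists_factor
    rw [hφ, hchain u hu]
    refine map_ker_eq_of_comp_eq ((hfd u hu).isInvertible.comp (hinv u)) hc fun w => ?_
    rw [← alphaSt_fderiv_rotToSt]
    exact hcu _

/-- The correction ∑ xᵢ yᵢ vanishes on the z-axis, so the half-line is fixed pointwise. -/
theorem bijOn_rotToSt_compl_halfLine :
    BijOn (rotToSt (n := n)) (halfLine n)ᶜ (halfLine n)ᶜ := by
  have hmem : ∀ w : ContactSpace n, rotToSt w ∈ halfLine n ↔ w ∈ halfLine n := by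
    intro w
    simp only [halfLine, rotToSt, mem_ofPred_eq, smul_eq_zero, two_ne_zero, false_or]
    refine and_congr_right fun h => ?_
    simp [h]
  refine ⟨fun w hw h => hw ((hmem w).1 h), fun a _ b _ hab => ?_, fun v hv => ?_⟩
  · simp only [rotToSt, Prod.mk.injEq] at hab
    obtain ⟨h1, h2, h3⟩ := hab
    have h1 : a.1 = b.1 := smul_right_injective _ (two_ne_zero (α := ℝ)) h1
    rw [h1, h2] at h3
    exact Prod.ext h1 (Prod.ext h2 (sub_left_injective h3))
  · have : rotToSt ((1 / 2 : ℝ) • v.1, v.2.1, v.2.2 + ∑ i, (1 / 2 * v.1 i) * v.2.1 i) = v := by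
      refine Prod.ext ?_ (Prod.ext rfl ?_)
      · ext i; simp [rotToSt]
      · simp [rotToSt]
    refine ⟨_, fun h => hv ?_, this⟩
    rw [← this]
    exact (hmem _).2 h

end ContactSpace

end

theorem propositionp (n : ℕ) :
    (∀ U : ℕ → Set (ContactSpace n),
      (∀ i, ContactSpace.IsDomainSet (U i)) →
      (∀ i, Bornology.IsBounded (U i)) →
      (∀ i, closure (U i) ⊆ U (i + 1)) →
      (∀ i, ContactSpace.Contactomorphic (U i) ContactSpace.xiSt
        Set.univ ContactSpace.xiSt) →
      ContactSpace.Contactomorphic (⋃ i, U i) ContactSpace.xiSt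
        Set.univ ContactSpace.xiSt) ∧
    ContactSpace.Contactomorphic (ContactSpace.halfLine n)ᶜ ContactSpace.xiRot
      Set.univ ContactSpace.xiSt ∧
    ContactSpace.Contactomorphic (ContactSpace.halfLine n)ᶜ ContactSpace.xiSt
      Set.univ ContactSpace.xiSt := by
  obtain ⟨f, hf⟩ := ContactSpace.exists_isContactoOn_compl_halfLine (n := n)
  refine ⟨fun U _ _ hcl h => ContactSpace.contactomorphic_iUnion_univ
    (monotone_nat_of_le_succ fun i => subset_closure.trans (hcl i)) h, ?_, hf.contactomorphic⟩
  exact ContactSpace.contactomorphic_rot_of_isContactoOn ContactSpace.isClosed_halfLine.isOpen_compl hf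
    ContactSpace.bijOn_rotToSt_compl_halfLine
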